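/- For $k\ge 2$ and $\ell\ge 1$ let $P_\ell^{(k)}$ denote the $k$-uniform loose path of length $\ell$: its vertex set is $\{v_1,\dots,v_{(k-1)\ell+1}\}$ and its edges are $e_i=\{v_{(i-1)(k-1)+q} : 1\le q\le k\}$, $i=1,\dots,\ell$. Let $K_n^{(k)}$ be the complete $k$-uniform hypergraph on $n$ vertices. There are an algorithm $A$ and a constant $c>0$ such that for all integers $k\ge 3$, $\ell\ge 3$, $2\le r\le k-1$ and $$n\ \ge\ k(\ell+1)r\left(1+\ln\left(1+\frac{r-1}{k-r}\right)\right)$$ the following holds: given $k,\ell,r,n$ and any coloring of the edges of $K_n^{(k)}$ with $r$ colors, $A$ finds a monochromatic copy of $P_\ell^{(k)}$ in time at most $c\,n^k$. In particular, with the same $A$ and $c$, this holds for all integers $k\ge 3$, $\ell\ge 3$, $2\le r\le k-1$ and $n\ge k(\ell+1)r(1+\ln r)$. Here an algorithm is a program for a random access machine whose registers and array entries hold natural numbers and whose arithmetic operations, addition and truncated subtraction, take unit time; the coloring is accessed by queries for the color of a single edge, each of which takes time $k+1$; and the output is the list of the vertices $v_1,\dots,v_{(k-1)\ell+1}$ of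 the copy in their order along the path. -/

import Mathlib

open Finset

/-! ### Hypergraphs, colorings and loose paths -/

/-- The edges of the complete `k`-uniform hypergraph on the vertex set `Fin n`. -/
abbrev CompleteEdge (n k : ℕ) : Type := {e : Finset (Fin n) // e.card = k}

/-- An `r`-edge-coloring of the complete `k`-uniform hypergraph on `n` vertices. -/
abbrev EdgeColoring (n k r : ℕ) : Type := CompleteEdge n k → Fin r

/-- The `i`-th edge (`i = 0, …, ℓ - 1`) of the `k`-uniform loose path with `ℓ` edges, whose vertices
are numbered `0, …, (k - 1) * ℓ`: it is the block of the `k` consecutive vertices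
`i * (k - 1), …, (i + 1) * (k - 1)`. -/
def loosePathEdge (k ℓ : ℕ) (i : Fin ℓ) : Finset (Fin ((k - 1) * ℓ + 1)) :=
  univ.filter fun v => (i : ℕ) * (k - 1) ≤ (v : ℕ) ∧ (v : ℕ) ≤ ((i : ℕ) + 1) * (k - 1)

/-- The edge set of the `k`-uniform loose path of length `ℓ`. -/
def loosePath (k ℓ : ℕ) : Finset (Finset (Fin ((k - 1) * ℓ + 1))) :=
  univ.image (loosePathEdge k ℓ)

/-- The injection `φ` embeds the hypergraph with edge set `F` in the complete `k`-uniform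
hypergraph on `Fin n` in such a way that the images of all edges have the same color. -/
def IsMonochromaticCopy {V : Type*} {n k r : ℕ} (F : Finset (Finset V)) (χ : EdgeColoring n k r)
    (φ : V ↪ Fin n) : Prop :=
  ∃ c : Fin r, ∀ e ∈ F, ∃ h : (e.map φ).card = k, χ ⟨e.map φ, h⟩ = c

/-! ### A random access machine

Programs manipulate scalar registers and arrays which hold natural numbers.  The only arithmetic
operations are addition and truncated subtraction.  The coloring can only be accessed by querying
the color of one edge at a time. -/

/-- Expressions: constants, registers, entries of arrays, sums and truncated differences. -/
inductive RamExpr : Type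
  | lit (m : ℕ)
  | reg (x : ℕ)
  | get (a : ℕ) (i : RamExpr)
  | plus (e₁ e₂ : RamExpr)
  | minus (e₁ e₂ : RamExpr)

/-- Programs.  `assign x e` is `x := e`; `store a i e` is `a[i] := e`; `query x a` writes the color
of the edge `{a[0], …, a[k - 1]}` to the register `x`; `ite b p q` and `loop b p` are
"if `b ≠ 0` then `p` else `q`" and "while `b ≠ 0` do `p`". -/
inductive RamProgram : Type
  | skip
  | assign (x : ℕ) (e : RamExpr)
  | store (a : ℕ) (i e : RamExpr)
  | query (x a : ℕ)
  | seq (p q : RamProgram)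
  | ite (b : RamExpr) (p q : RamProgram)
  | loop (b : RamExpr) (p : RamProgram)

/-- The memory: the contents of the registers and of the arrays. -/
structure RamState : Type where
  reg : ℕ → ℕ
  arr : ℕ → ℕ → ℕ

namespace RamState

/-- Change the content of the register `x` to `m`. -/
def setReg (s : RamState) (x m : ℕ) : RamState :=
  { s with reg := Function.update s.reg x m }

/-- Change the entry with index `i` of the array `a` to `m`. -/
def setArr (s : RamState) (a i m : ℕ) : RamState :=
  { s with arr := Function.update s.arr a (Function.update (s.arr a) i m) }

/-- The initial memory: the registers `0, 1, 2, 3` contain `k, ℓ, r, n`, everything else is `0`. -/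
def init (k ℓ r n : ℕ) : RamState where
  reg x := if x = 0 then k else if x = 1 then ℓ else if x = 2 then r else if x = 3 then n else 0
  arr _ _ := 0

end RamState

namespace RamExpr

/-- The value of an expression. -/
def eval (s : RamState) : RamExpr → ℕ
  | lit m => m
  | reg x => s.reg x
  | get a i => s.arr a (i.eval s)
  | plus e₁ e₂ => e₁.eval s + e₂.eval s
  | minus e₁ e₂ => e₁.eval s - e₂.eval s

/-- The number of steps needed to evaluate an expression: one for each symbol in it. -/
def cost : RamExpr → ℕ
  | lit _ => 1
  | reg _ => 1
  | get _ i => i.cost + 1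
  | plus e₁ e₂ => e₁.cost + e₂.cost + 1
  | minus e₁ e₂ => e₁.cost + e₂.cost + 1

end RamExpr

/-- The set of those vertices of `Fin n` that occur among `f 0, …, f (k - 1)`.  It has `k` elements
if and only if `f 0, …, f (k - 1)` are distinct vertices. -/
def listedVertices (n k : ℕ) (f : ℕ → ℕ) : Finset (Fin n) :=
  univ.filter fun v => ∃ i < k, f i = (v : ℕ)

/-- The answer to a query: the color (a number less than `r`) of the edge `{f 0, …, f (k - 1)}`,
and `r` if `f 0, …, f (k - 1)` are not distinct vertices. -/
def queriedColor {n k r : ℕ} (χ : EdgeColoring n k r) (f : ℕ → ℕ) : ℕ :=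
  if h : (listedVertices n k f).card = k then (χ ⟨listedVertices n k f, h⟩ : ℕ) else r

/-- `Exec χ p s s' t`: started in the memory `s`, with access to the coloring `χ`, the program `p`
halts after exactly `t` steps with the memory `s'`.  A query takes `k + 1` steps, because the `k`
vertices of the edge have to be read. -/
inductive Exec {n k r : ℕ} (χ : EdgeColoring n k r) :
    RamProgram → RamState → RamState → ℕ → Prop
  | skip (s : RamState) : Exec χ .skip s s 1
  | assign (s : RamState) (x : ℕ) (e : RamExpr) :
      Exec χ (.assign x e) s (s.setReg x (e.eval s)) (e.cost + 1)
  | store (s : RamState) (a : ℕ) (i e : RamExpr) :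
      Exec χ (.store a i e) s (s.setArr a (i.eval s) (e.eval s)) (i.cost + e.cost + 1)
  | query (s : RamState) (x a : ℕ) :
      Exec χ (.query x a) s (s.setReg x (queriedColor χ (s.arr a))) (k + 1)
  | seq {p q : RamProgram} {s₁ s₂ s₃ : RamState} {t₁ t₂ : ℕ} (hp : Exec χ p s₁ s₂ t₁)
      (hq : Exec χ q s₂ s₃ t₂) : Exec χ (.seq p q) s₁ s₃ (t₁ + t₂)
  | ite_true {b : RamExpr} {p q : RamProgram} {s s' : RamState} {t : ℕ} (hb : b.eval s ≠ 0)
      (hp : Exec χ p s s' t) : Exec χ (.ite b p q) s s' (b.cost + 1 + t)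
  | ite_false {b : RamExpr} {p q : RamProgram} {s s' : RamState} {t : ℕ} (hb : b.eval s = 0)
      (hq : Exec χ q s s' t) : Exec χ (.ite b p q) s s' (b.cost + 1 + t)
  | loop_true {b : RamExpr} {p : RamProgram} {s₁ s₂ s₃ : RamState} {t₁ t₂ : ℕ}
      (hb : b.eval s₁ ≠ 0) (hp : Exec χ p s₁ s₂ t₁) (hl : Exec χ (.loop b p) s₂ s₃ t₂) :
      Exec χ (.loop b p) s₁ s₃ (b.cost + 1 + t₁ + t₂)
  | loop_false {b : RamExpr} {p : RamProgram} {s : RamState} (hb : b.eval s = 0) :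
      Exec χ (.loop b p) s s (b.cost + 1)

/-- The machine is deterministic: the final memory and the number of steps are unique. -/
theorem Exec.deterministic {n k r : ℕ} {χ : EdgeColoring n k r} {p : RamProgram}
    {s s₁ s₂ : RamState} {t₁ t₂ : ℕ} (h₁ : Exec χ p s s₁ t₁) (h₂ : Exec χ p s s₂ t₂) :
    s₁ = s₂ ∧ t₁ = t₂ := by
  induction h₁ generalizing s₂ t₂ with
  | skip | assign | store | query => cases h₂; exact ⟨rfl, rfl⟩
  | seq _ _ ih₁ ih₂ =>
    cases h₂ with
    | seq hp hq =>
      obtain ⟨rfl, rfl⟩ := ih₁ hp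
      obtain ⟨rfl, rfl⟩ := ih₂ hq
      exact ⟨rfl, rfl⟩
  | ite_true hb _ ih =>
    cases h₂ with
    | ite_true _ hp => obtain ⟨rfl, rfl⟩ := ih hp; exact ⟨rfl, rfl⟩
    | ite_false hb' _ => exact absurd hb' hb
  | ite_false hb _ ih =>
    cases h₂ with
    | ite_true hb' _ => exact absurd hb hb'
    | ite_false _ hp => obtain ⟨rfl, rfl⟩ := ih hp; exact ⟨rfl, rfl⟩
  | loop_true hb _ _ ih₁ ih₂ =>
    cases h₂ with
    | loop_true _ hp hl =>
      obtain ⟨rfl, rfl⟩ := ih₁ hp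
      obtain ⟨rfl, rfl⟩ := ih₂ hl
      exact ⟨rfl, rfl⟩
    | loop_false hb' => exact absurd hb' hb
  | loop_false hb =>
    cases h₂ with
    | loop_true hb' _ _ => exact absurd hb hb'
    | loop_false _ => exact ⟨rfl, rfl⟩

/-- For every `r`-edge-coloring of the complete `k`-uniform hypergraph on `n` vertices, the program
`A`, started with the input `k, ℓ, r, n` and with access to the coloring, halts within `c * n ^ k`
steps, and then the array `0` lists the vertices, in their order along the path, of a monochromatic
copy of the `k`-uniform loose path of length `ℓ`. -/
def FindsMonochromaticLoosePath (A : RamProgram) (c : ℝ) (k ℓ r n : ℕ) : Prop :=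
  ∀ χ : EdgeColoring n k r, ∃ (s : RamState) (t : ℕ),
    Exec χ A (RamState.init k ℓ r n) s t ∧ (t : ℝ) ≤ c * (n : ℝ) ^ k ∧
      ∃ φ : Fin ((k - 1) * ℓ + 1) ↪ Fin n,
        (∀ j : Fin ((k - 1) * ℓ + 1), s.arr 0 (j : ℕ) = (φ j : ℕ)) ∧ IsMonochromaticCopy (loosePath k ℓ) χ φ

/-! ### Total correctness of programs with a time bound -/

namespace RamState

/-! Stage `i` is a depth-first search for a path of color `i - 1`. A candidate edge consists of the
current end vertex `v`, one vertex discarded in each of the stages `1, …, i - 1`, and `k - i` unused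
vertices. If some candidate has the right color, the path grows, and the `k - i` formerly unused
vertices become live, that is, possible later end vertices. If none has, `v` is discarded; the
search goes on from another live vertex of the last edge, drops that edge if it has none, or takes
an unused vertex as a new root. After `d i` discards stage `i + 1` starts afresh.

Why some stage succeeds: an edge with one vertex from each of the classes `1, …, a` whose other
vertices were still unused after stage `a` cannot have color `a - 1`. Indeed, when its vertex of
class `a` was discarded, the edge was a candidate, because classes only lose vertices afterwards
(`SearchInv.discard`). In stage `r` a candidate is such an edge for every `a < r`, so only the color
`r - 1` is left, and the path can always be extended (`SearchInv.exists_extension`).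

Why the supply lasts: an extension in stage `i` costs one vertex of each earlier class and creates
`k - i` live vertices, each of which is later discarded or still on the path; a path with fewer than
`ℓ` edges carries at most `(k - i) * (ℓ - 1) + 1` of them. Hence a class loses at most about `d i /
(k - i) + ℓ` vertices, which dictates the recursion for `d`, starting from `d r = 1`
(`SearchInv.nextStage`). Up to normalization the recursion adds up a harmonic sum, whence the
logarithm (`threshold_le`). The sum of all `d a`, plus `k * ℓ` abandoned live vertices per stage, is
at most `n`.

Running time: a potential that is initially at most `5 * n + 1` decreases in every round
(`Runs.searchStep`). A round tests at most `n.choose (k - 1)` candidates, in colexicographic order,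
with `O(k ^ 2)` steps for each, and `k * (k + 1) * n.choose (k - 1) ≤ 6 * n ^ (k - 1)`. -/

@[simp] theorem setReg_reg (s : RamState) (x m y : ℕ) :
    (s.setReg x m).reg y = if y = x then m else s.reg y := by
  simp [setReg, Function.update_apply]

@[simp] theorem setReg_arr (s : RamState) (x m : ℕ) : (s.setReg x m).arr = s.arr := rfl

@[simp] theorem setArr_reg (s : RamState) (a i m : ℕ) : (s.setArr a i m).reg = s.reg := rfl

@[simp] theorem setArr_arr (s : RamState) (a i m b : ℕ) :
    (s.setArr a i m).arr b = if b = a then Function.update (s.arr a) i m else s.arr b := by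
  simp only [setArr, Function.update_apply]

end RamState

namespace RamProgram

/-- The registers that a program may change. -/
def regs : RamProgram → List ℕ
  | skip => []
  | assign x _ => [x]
  | store _ _ _ => []
  | query x _ => [x]
  | seq p q => p.regs ++ q.regs
  | ite _ p q => p.regs ++ q.regs
  | loop _ p => p.regs

/-- The arrays that a program may change. -/
def arrs : RamProgram → List ℕ
  | skip => []
  | assign _ _ => []
  | store a _ _ => [a]
  | query _ _ => []
  | seq p q => p.arrs ++ q.arrs
  | ite _ p q => p.arrs ++ q.arrs
  | loop _ p => p.arrs

/-- The two memories agree on everything that `p` cannot change. -/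
structure Agree (p : RamProgram) (s s' : RamState) : Prop where
  reg : ∀ x, x ∉ p.regs → s'.reg x = s.reg x
  arr : ∀ a, a ∉ p.arrs → s'.arr a = s.arr a

theorem Agree.refl (p : RamProgram) (s : RamState) : p.Agree s s := ⟨fun _ _ => rfl, fun _ _ => rfl⟩

theorem Agree.trans {p : RamProgram} {s₁ s₂ s₃ : RamState} (h : p.Agree s₁ s₂)
    (h' : p.Agree s₂ s₃) : p.Agree s₁ s₃ :=
  ⟨fun x hx => (h'.reg x hx).trans (h.reg x hx), fun a ha => (h'.arr a ha).trans (h.arr a ha)⟩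

theorem Agree.mono {p q : RamProgram} {s s' : RamState} (h : p.Agree s s')
    (hr : p.regs ⊆ q.regs) (ha : p.arrs ⊆ q.arrs) : q.Agree s s' :=
  ⟨fun x hx => h.reg x fun h' => hx (hr h'), fun a hx => h.arr a fun h' => hx (ha h')⟩

end RamProgram

/-- The frame rule: whatever a program has no instruction to write survives its execution. Later
proofs need only check by `decide` that a register or array is not in the list. -/
theorem Exec.agree {n k r : ℕ} {χ : EdgeColoring n k r} {p : RamProgram} {s s' : RamState} {t : ℕ}
    (h : Exec χ p s s' t) : p.Agree s s' := by
  induction h with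
  | skip => exact .refl _ _
  | assign s x e =>
    refine ⟨fun y hy => ?_, fun _ _ => rfl⟩
    have : y ≠ x := by simpa [RamProgram.regs] using hy
    simp [this]
  | store s a i e =>
    refine ⟨fun _ _ => rfl, fun b hb => ?_⟩
    have : b ≠ a := by simpa [RamProgram.arrs] using hb
    simp [this]
  | query s x a =>
    refine ⟨fun y hy => ?_, fun _ _ => rfl⟩
    have : y ≠ x := by simpa [RamProgram.regs] using hy
    simp [this]
  | seq _ _ h₁ h₂ =>
    exact (h₁.mono (by simp [RamProgram.regs]) (by simp [RamProgram.arrs])).trans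
      (h₂.mono (by simp [RamProgram.regs]) (by simp [RamProgram.arrs]))
  | ite_true _ _ h => exact h.mono (by simp [RamProgram.regs]) (by simp [RamProgram.arrs])
  | ite_false _ _ h => exact h.mono (by simp [RamProgram.regs]) (by simp [RamProgram.arrs])
  | loop_true _ _ _ h₁ h₂ =>
    exact (h₁.mono (q := .loop _ _) (List.Subset.refl _) (List.Subset.refl _)).trans h₂
  | loop_false => exact .refl _ _

/-- Started in `s`, the program `p` halts within `T` steps in a memory that satisfies `Q`. -/
def Runs {n k r : ℕ} (χ : EdgeColoring n k r) (p : RamProgram) (s : RamState) (T : ℕ)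
    (Q : RamState → Prop) : Prop :=
  ∃ s' t, Exec χ p s s' t ∧ t ≤ T ∧ Q s'

namespace Runs

variable {n k r : ℕ} {χ : EdgeColoring n k r} {p q : RamProgram} {s : RamState} {T T' : ℕ}
  {Q Q' : RamState → Prop} {b : RamExpr}

theorem conseq (h : Runs χ p s T Q) (hT : T ≤ T')
    (hQ : ∀ s', p.Agree s s' → Q s' → Q' s') : Runs χ p s T' Q' := by
  obtain ⟨s', t, h₁, h₂, h₃⟩ := h
  exact ⟨s', t, h₁, h₂.trans hT, hQ s' h₁.agree h₃⟩

theorem le_time (h : Runs χ p s T Q) (hT : T ≤ T') : Runs χ p s T' Q :=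
  h.conseq hT fun _ _ h => h

theorem skip (h : Q s) : Runs χ .skip s 1 Q := ⟨s, 1, .skip s, le_rfl, h⟩

theorem assign {x : ℕ} {e : RamExpr} (h : Q (s.setReg x (e.eval s))) :
    Runs χ (.assign x e) s (e.cost + 1) Q := ⟨_, _, .assign s x e, le_rfl, h⟩

theorem store {a : ℕ} {i e : RamExpr} (h : Q (s.setArr a (i.eval s) (e.eval s))) :
    Runs χ (.store a i e) s (i.cost + e.cost + 1) Q := ⟨_, _, .store s a i e, le_rfl, h⟩

theorem query {x a : ℕ} (h : Q (s.setReg x (queriedColor χ (s.arr a)))) :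
    Runs χ (.query x a) s (k + 1) Q := ⟨_, _, .query s x a, le_rfl, h⟩

theorem seq (h : Runs χ p s T fun s' => Runs χ q s' T' Q) : Runs χ (.seq p q) s (T + T') Q := by
  obtain ⟨s₁, t₁, h₁, ht₁, s₂, t₂, h₂, ht₂, h⟩ := h
  exact ⟨s₂, t₁ + t₂, .seq h₁ h₂, add_le_add ht₁ ht₂, h⟩

theorem seq_of {P : RamState → Prop} (h : Runs χ p s T P)
    (h' : ∀ s', p.Agree s s' → P s' → Runs χ q s' T' Q) : Runs χ (.seq p q) s (T + T') Q :=
  seq (h.conseq le_rfl h')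

theorem seq_assign {x : ℕ} {e : RamExpr} (h : Runs χ q (s.setReg x (e.eval s)) T Q) :
    Runs χ (.seq (.assign x e) q) s (e.cost + 1 + T) Q := seq (assign h)

theorem seq_store {a : ℕ} {i e : RamExpr} (h : Runs χ q (s.setArr a (i.eval s) (e.eval s)) T Q) :
    Runs χ (.seq (.store a i e) q) s (i.cost + e.cost + 1 + T) Q := seq (store h)

theorem seq_query {x a : ℕ} (h : Runs χ q (s.setReg x (queriedColor χ (s.arr a))) T Q) :
    Runs χ (.seq (.query x a) q) s (k + 1 + T) Q := seq (query h)

theorem ite (h₁ : b.eval s ≠ 0 → Runs χ p s T Q) (h₂ : b.eval s = 0 → Runs χ q s T Q) :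
    Runs χ (.ite b p q) s (b.cost + 1 + T) Q := by
  by_cases hb : b.eval s = 0
  · obtain ⟨s', t, h, ht, hq⟩ := h₂ hb
    exact ⟨s', _, .ite_false hb h, by lia, hq⟩
  · obtain ⟨s', t, h, ht, hq⟩ := h₁ hb
    exact ⟨s', _, .ite_true hb h, by lia, hq⟩

/-- The rule for loops: `I` is an invariant, `μ` decreases in every round. -/
theorem loop (I : RamState → Prop) (μ : RamState → ℕ) (B : ℕ) (h₀ : I s)
    (h : ∀ s', p.Agree s s' → I s' → b.eval s' ≠ 0 →
      Runs χ p s' B fun s'' => I s'' ∧ μ s'' < μ s') :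
    Runs χ (.loop b p) s (μ s * (b.cost + 1 + B) + (b.cost + 1)) fun s' => I s' ∧ b.eval s' = 0 := by
  -- The current memory is generalized but keeps its agreement with `s`, so that the hypothesis on
  -- the body applies in every round.
  suffices H : ∀ m s', μ s' ≤ m → p.Agree s s' → I s' →
      Runs χ (.loop b p) s' (m * (b.cost + 1 + B) + (b.cost + 1)) fun s' => I s' ∧ b.eval s' = 0 from
    H _ s le_rfl (.refl _ _) h₀
  intro m
  induction m with
  | zero =>
    intro s' hm ha hI
    by_cases hb : b.eval s' = 0
    · exact ⟨s', _, .loop_false hb, by lia, hI, hb⟩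
    · obtain ⟨_, _, _, _, _, h'⟩ := h s' ha hI hb
      lia
  | succ m ih =>
    intro s' hm ha hI
    by_cases hb : b.eval s' = 0
    · exact ⟨s', _, .loop_false hb, by lia, hI, hb⟩
    · obtain ⟨s₁, t₁, h₁, ht₁, hI₁, hm₁⟩ := h s' ha hI hb
      obtain ⟨s₂, t₂, h₂, ht₂, hI₂⟩ := ih s₁ (by lia) (ha.trans h₁.agree) hI₁
      refine ⟨s₂, _, .loop_true hb h₁ h₂, ?_, hI₂⟩
      rw [add_one_mul]
      lia

end Runs

/-! ### Enumeration of the increasing sequences -/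

/-- The entries `x 1, …, x (k - 1)` are increasing and less than the sentinel `x k = n`. -/
structure Combo (k n : ℕ) (x : ℕ → ℕ) : Prop where
  lt : ∀ p, 1 ≤ p → p < k → x p < x (p + 1)
  top : x k = n

/-- The position of `x` in the colexicographic order. -/
def comboRank (k : ℕ) (x : ℕ → ℕ) : ℕ := ∑ p ∈ Ico 1 k, (x p).choose p

theorem comboRank_succ {j : ℕ} (hj : 1 ≤ j) (x : ℕ → ℕ) :
    comboRank (j + 1) x = comboRank j x + (x j).choose j := sum_Ico_succ_top hj _

/-- Pascal's rule: adding the term `(x j).choose j` to a number below `(x j).choose (j - 1)` stays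
below `(x j + 1).choose j`, and `x j + 1 ≤ x (j + 1)`. -/
theorem comboRank_lt {x : ℕ → ℕ} {j : ℕ} (hj : 1 ≤ j) (h : ∀ p, 1 ≤ p → p < j → x p < x (p + 1)) :
    comboRank j x < (x j).choose (j - 1) := by
  induction j, hj using Nat.le_induction with
  | base => simp [comboRank]
  | succ j hj ih =>
    have h₁ := ih fun p hp hp' => h p hp (by lia)
    rw [comboRank_succ hj]
    obtain ⟨i, rfl⟩ : ∃ i, j = i + 1 := ⟨j - 1, by lia⟩
    simp only [Nat.add_sub_cancel] at *
    calc _ < (x (i + 1)).choose i + (x (i + 1)).choose (i + 1) := by lia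
      _ = (x (i + 1) + 1).choose (i + 1) := (Nat.choose_succ_succ _ _).symm
      _ ≤ _ := Nat.choose_le_choose _ (h _ (by lia) (by lia))

theorem Combo.rank_lt {k n : ℕ} {x : ℕ → ℕ} (hk : 1 ≤ k) (h : Combo k n x) :
    comboRank k x < n.choose (k - 1) := by
  simpa [h.top] using comboRank_lt hk h.lt

/-- Uniqueness in the combinatorial number system: by `comboRank_lt` the lower terms never
compensate for a smaller top entry, so the top entries agree, and one descends. -/
theorem eq_of_comboRank_eq {x y : ℕ → ℕ} {j : ℕ} (hx : ∀ p, 1 ≤ p → p + 1 < j → x p < x (p + 1))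
    (hy : ∀ p, 1 ≤ p → p + 1 < j → y p < y (p + 1)) (h : comboRank j x = comboRank j y) :
    ∀ p, 1 ≤ p → p < j → x p = y p := by
  induction j with
  | zero => lia
  | succ j ih =>
    rcases Nat.eq_zero_or_pos j with rfl | hj
    · lia
    have key : ∀ x y : ℕ → ℕ, (∀ p, 1 ≤ p → p + 1 < j + 1 → x p < x (p + 1)) →
        x j < y j → comboRank (j + 1) x < comboRank (j + 1) y := by
      intro x y hx hxy
      have h₁ := comboRank_lt hj fun p hp hp' => hx p hp (by lia)
      rw [comboRank_succ hj, comboRank_succ hj]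
      obtain ⟨i, rfl⟩ : ∃ i, j = i + 1 := ⟨j - 1, by lia⟩
      have h₂ := Nat.choose_le_choose (i + 1) (Nat.succ_le_of_lt hxy)
      rw [Nat.choose_succ_succ] at h₂
      simp only [Nat.add_sub_cancel, Nat.succ_eq_add_one] at *
      lia
    have hxy : x j = y j := by
      rcases lt_trichotomy (x j) (y j) with h' | h' | h'
      · exact absurd h (key x y hx h').ne
      · exact h'
      · exact absurd h (key y x hy h').ne'
    rw [comboRank_succ hj, comboRank_succ hj, hxy, Nat.add_right_cancel_iff] at h
    intro p hp hp'
    rcases Nat.lt_succ_iff_lt_or_eq.1 hp' with h' | rfl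
    · exact ih (fun p hp hp' => hx p hp (by lia)) (fun p hp hp' => hy p hp (by lia)) h p hp h'
    · exact hxy

theorem Combo.strictMono {k n : ℕ} {x : ℕ → ℕ} (h : Combo k n x) {p q : ℕ} (hp : 1 ≤ p)
    (hpq : p < q) (hq : q ≤ k) : x p < x q := by
  induction q, hpq using Nat.le_induction with
  | base => exact h.lt p hp (by lia)
  | succ q hq' ih => exact (ih (by lia)).trans (h.lt q (by lia) (by lia))

theorem Combo.lt_top {k n : ℕ} {x : ℕ → ℕ} (h : Combo k n x) {p : ℕ} (hp : 1 ≤ p)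
    (hpk : p < k) : x p < n := h.top ▸ h.strictMono hp hpk le_rfl

/-- The entries `y 1, …, y (k - 1)` have labels less than `i`, and each of the labels
`1, …, i - 1` occurs exactly once. -/
structure Admissible (k i : ℕ) (lab y : ℕ → ℕ) : Prop where
  lt : ∀ p, 1 ≤ p → p < k → lab (y p) < i
  card : ∀ b, 1 ≤ b → b < i → #{p ∈ Ico 1 k | lab (y p) = b} = 1

theorem Admissible.congr {k i : ℕ} {lab y z : ℕ → ℕ} (h : Admissible k i lab y)
    (hyz : ∀ p, 1 ≤ p → p < k → y p = z p) : Admissible k i lab z := by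
  refine ⟨fun p hp hp' => hyz p hp hp' ▸ h.lt p hp hp', fun b hb hb' => ?_⟩
  refine Eq.trans ?_ (h.card b hb hb')
  refine congrArg Finset.card (filter_congr fun p hp => ?_)
  rw [mem_Ico] at hp
  rw [hyz p hp.1 hp.2]

theorem queriedColor_congr {n k r : ℕ} (χ : EdgeColoring n k r) {f g : ℕ → ℕ}
    (h : ∀ p < k, f p = g p) : queriedColor χ f = queriedColor χ g := by
  have : listedVertices n k f = listedVertices n k g := by
    refine filter_congr fun v _ => exists_congr fun p => and_congr_right fun hp => ?_
    rw [h p hp]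
  simp only [queriedColor, this]

theorem card_filter_Ico_succ (P : ℕ → Prop) [DecidablePred P] {j : ℕ} (hj : 1 ≤ j) :
    #{p ∈ Ico 1 (j + 1) | P p} = #{p ∈ Ico 1 j | P p} + if P j then 1 else 0 := by
  rw [Nat.Ico_succ_right_eq_insert_Ico hj, filter_insert]
  split_ifs <;> simp

theorem forall_lt_succ_iff (P : ℕ → Prop) {a j : ℕ} (hj : a ≤ j) :
    (∀ p, a ≤ p → p < j + 1 → P p) ↔ (∀ p, a ≤ p → p < j → P p) ∧ P j := by
  refine ⟨fun h => ⟨fun p hp hp' => h p hp (by omega), h j hj (by omega)⟩, fun h p hp hp' => ?_⟩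
  rcases Nat.lt_succ_iff_lt_or_eq.1 hp' with h' | rfl
  exacts [h.1 p hp h', h.2]

theorem Combo.le {k n : ℕ} {x : ℕ → ℕ} (h : Combo k n x) {p : ℕ} (hp : 1 ≤ p) (hpk : p ≤ k) :
    p ≤ x p + 1 := by
  induction p, hp using Nat.le_induction with
  | base => omega
  | succ p hp ih =>
    have := h.lt p hp (by omega)
    have := ih (by omega)
    omega

/-! ### The search for an edge -/

infixr:65 " ⨟ " => RamProgram.seq

namespace RamExpr

/-- An expression whose value is nonzero if and only if the values of `a` and `b` are different. -/
def ne (a b : RamExpr) : RamExpr := plus (minus a b) (minus b a)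

theorem eval_ne {s : RamState} {a b : RamExpr} : (ne a b).eval s = 0 ↔ a.eval s = b.eval s := by
  simp only [ne, eval]; lia

@[simp] theorem cost_ne {a b : RamExpr} : (ne a b).cost = 2 * (a.cost + b.cost) + 3 := by
  simp only [ne, cost]; lia

end RamExpr

namespace RamProgram

open RamExpr

/-- Counts the entries among `Q[1], …, Q[k - 1]` whose label is the content of register 14. -/
def countLabel : RamProgram :=
  -- Throughout, register 4 holds the number of path edges, 5 the index of the last path vertex, 6
  -- the stage, 7 the number of discards in it; 9 means "edge found", 10 "keep searching". Array 0
  -- is the path, 1 the candidate edge with the end vertex at index 0, 2 the labels, 4 the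
  -- thresholds.
  assign 13 (lit 0) ⨟ assign 8 (lit 1) ⨟
  loop (minus (reg 0) (reg 8))
    (ite (ne (get 2 (get 1 (reg 8))) (reg 14)) skip (assign 13 (plus (reg 13) (lit 1))) ⨟
    assign 8 (plus (reg 8) (lit 1)))

/-- Decides whether `Q[1], …, Q[k - 1]` is admissible. -/
def checkLabels : RamProgram :=
  assign 11 (lit 1) ⨟ assign 8 (lit 1) ⨟
  loop (minus (reg 0) (reg 8))
    -- With truncated subtraction the flag drops to `0` at the first violation and stays there.
    (assign 11 (minus (reg 11) (minus (plus (get 2 (get 1 (reg 8))) (lit 1)) (reg 6))) ⨟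
    assign 8 (plus (reg 8) (lit 1))) ⨟
  assign 14 (lit 1) ⨟
  loop (minus (reg 6) (reg 14))
    (countLabel ⨟ assign 11 (minus (reg 11) (ne (reg 13) (lit 1))) ⨟
    assign 14 (plus (reg 14) (lit 1)))

/-- Moves on to the next increasing sequence, or sets register 10 to `0` if there is none. -/
def advance : RamProgram :=
  assign 8 (lit 1) ⨟
  -- Runs while the entry cannot be raised without meeting its successor. The sentinels `n` at `k`
  -- and `n + 2` at `k + 1` stop it at position `k`.
  loop (minus (plus (get 1 (reg 8)) (lit 2)) (get 1 (plus (reg 8) (lit 1))))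
    (store 1 (reg 8) (minus (reg 8) (lit 1)) ⨟ assign 8 (plus (reg 8) (lit 1))) ⨟
  ite (minus (reg 0) (reg 8)) (store 1 (reg 8) (plus (get 1 (reg 8)) (lit 1))) (assign 10 (lit 0))

/-- Examines the current sequence and moves on if it does not give an edge of the right color. -/
def examine : RamProgram :=
  checkLabels ⨟
  ite (reg 11)
    (query 12 1 ⨟ ite (ne (plus (reg 12) (lit 1)) (reg 6)) skip
      (assign 9 (lit 1) ⨟ assign 10 (lit 0)))
    skip ⨟
  ite (reg 9) skip advance

/-- Writes the first increasing sequence to the array 1. -/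
def firstCombo : RamProgram :=
  store 1 (lit 0) (get 0 (reg 5)) ⨟ assign 8 (lit 1) ⨟
  loop (minus (reg 0) (reg 8))
    (store 1 (reg 8) (minus (reg 8) (lit 1)) ⨟ assign 8 (plus (reg 8) (lit 1))) ⨟
  store 1 (reg 0) (reg 3) ⨟ store 1 (plus (reg 0) (lit 1)) (plus (reg 3) (lit 2)) ⨟
  assign 9 (lit 0) ⨟ assign 10 (lit 1)

/-- Searches for an edge of the color of the current stage which extends the path. -/
def search : RamProgram := firstCombo ⨟ loop (reg 10) examine

end RamProgram

/-! ### Correctness and cost of the search for an edge -/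

namespace Runs

open RamProgram RamExpr

variable {n k r : ℕ} {χ : EdgeColoring n k r} {s : RamState}

theorem countLabel (hk : 1 ≤ s.reg 0) :
    Runs χ countLabel s (30 * s.reg 0) fun s' =>
      s'.reg 13 = #{p ∈ Ico 1 (s.reg 0) | s.arr 2 (s.arr 1 p) = s.reg 14} := by
  refine (seq_assign (seq_assign (loop
    (fun s' => 1 ≤ s'.reg 8 ∧ s'.reg 8 ≤ s.reg 0 ∧
      s'.reg 13 = #{p ∈ Ico 1 (s'.reg 8) | s.arr 2 (s.arr 1 p) = s.reg 14})
    (fun s' => s.reg 0 - s'.reg 8) 25 ?_ ?_))).conseq ?_ ?_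
  · simp [eval, hk]
  · rintro s' ha ⟨h₁, h₂, h₃⟩ hb
    have e0 : s'.reg 0 = s.reg 0 := by simpa using ha.reg 0 (by decide)
    have e14 : s'.reg 14 = s.reg 14 := by simpa using ha.reg 14 (by decide)
    have e1 : s'.arr 1 = s.arr 1 := by simpa using ha.arr 1 (by decide)
    have e2 : s'.arr 2 = s.arr 2 := by simpa using ha.arr 2 (by decide)
    have hlt : s'.reg 8 < s.reg 0 := by simp only [eval, e0] at hb; lia
    refine le_time (T := 25) ?_ le_rfl
    refine le_time (seq (T := 20) (T' := 5) ?_) (by simp)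
    refine le_time (ite (T := 4) (fun hc => le_time (skip ?_) (by simp)) fun hc =>
      le_time (assign ?_) (by simp [cost])) (by simp [cost])
    all_goals
      rw [Ne, eval_ne] at *
      refine le_time (assign ?_) (by simp [cost])
      simp only [eval, e1, e2, e14] at hc
      simp [eval, card_filter_Ico_succ _ h₁, hc, h₃]
      omega
  · simp [cost, eval]; omega
  · rintro s' ha ⟨⟨h₁, h₂, h₃⟩, hb⟩
    have e0 : s'.reg 0 = s.reg 0 := by simpa using ha.reg 0 (by decide)
    simp only [eval, e0] at hb
    rw [h₃, show s'.reg 8 = s.reg 0 by omega]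

theorem checkLabels (hk : 1 ≤ s.reg 0) :
    Runs χ checkLabels s (100 * s.reg 0 * (s.reg 6 + 1)) fun s' => s'.reg 11 ≤ 1 ∧
      (s'.reg 11 = 1 ↔ Admissible (s.reg 0) (s.reg 6) (s.arr 2) (s.arr 1)) := by
  refine le_time (seq_assign (seq_assign (seq_of (loop
    (fun s' => 1 ≤ s'.reg 8 ∧ s'.reg 8 ≤ s.reg 0 ∧ s'.reg 11 ≤ 1 ∧
      (s'.reg 11 = 1 ↔ ∀ p, 1 ≤ p → p < s'.reg 8 → s.arr 2 (s.arr 1 p) < s.reg 6))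
    (fun s' => s.reg 0 - s'.reg 8) 25 ?_ ?_) fun s₁ ha₁ h₁ => seq_assign (conseq (loop
    -- The alternative `s'.reg 14 = 1` covers `s.reg 6 = 0`, when this loop does not run at all.
    (fun s' => 1 ≤ s'.reg 14 ∧ (s'.reg 14 ≤ s.reg 6 ∨ s'.reg 14 = 1) ∧ s'.reg 11 ≤ 1 ∧
      (s'.reg 11 = 1 ↔ (∀ p, 1 ≤ p → p < s.reg 0 → s.arr 2 (s.arr 1 p) < s.reg 6) ∧
        ∀ b, 1 ≤ b → b < s'.reg 14 → #{p ∈ Ico 1 (s.reg 0) | s.arr 2 (s.arr 1 p) = b} = 1))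
    (fun s' => s.reg 6 - s'.reg 14) (60 * s.reg 0) ?_ ?_)
    (T' := 70 * s.reg 0 * s.reg 6 + 10) ?_ ?_)))) ?_
  · refine ⟨by simp [eval], by simpa [eval] using hk, by simp [eval], ?_⟩
    simp [eval]; omega
  · rintro s' ha ⟨h₁, h₂, h₃, h₄⟩ hb
    have e0 : s'.reg 0 = s.reg 0 := by simpa using ha.reg 0 (by decide)
    have e6 : s'.reg 6 = s.reg 6 := by simpa using ha.reg 6 (by decide)
    have e1 : s'.arr 1 = s.arr 1 := by simpa using ha.arr 1 (by decide)
    have e2 : s'.arr 2 = s.arr 2 := by simpa using ha.arr 2 (by decide)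
    have hlt : s'.reg 8 < s.reg 0 := by simp only [eval, e0] at hb; omega
    refine le_time (seq_assign (assign ?_)) (by simp [cost])
    have key := forall_lt_succ_iff (fun p => s.arr 2 (s.arr 1 p) < s.reg 6) h₁
    simp only [eval, e1, e2, e6, RamState.setReg_reg, if_true, Nat.reduceEqDiff, if_false, key,
      ← h₄]
    omega
  · have e0 : s₁.reg 0 = s.reg 0 := by simpa using ha₁.reg 0 (by decide)
    have e6 : s₁.reg 6 = s.reg 6 := by simpa using ha₁.reg 6 (by decide)
    obtain ⟨⟨h₁, h₂, h₃, h₄⟩, h₅⟩ := h₁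
    simp only [eval, e0] at h₅
    rw [show s₁.reg 8 = s.reg 0 by omega] at h₄
    simp [eval, h₃, h₄]
    omega
  · rintro s' ha ⟨h₁, h₂, h₃, h₄⟩ hb
    have e0 : s'.reg 0 = s.reg 0 := by simpa [ha₁.reg 0 (by decide)] using ha.reg 0 (by decide)
    have e6 : s'.reg 6 = s.reg 6 := by simpa [ha₁.reg 6 (by decide)] using ha.reg 6 (by decide)
    have e1 : s'.arr 1 = s.arr 1 := by simpa [ha₁.arr 1 (by decide)] using ha.arr 1 (by decide)
    have e2 : s'.arr 2 = s.arr 2 := by simpa [ha₁.arr 2 (by decide)] using ha.arr 2 (by decide)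
    have hlt : s'.reg 14 < s.reg 6 := by simp only [eval, e6] at hb; omega
    refine le_time (seq_of (T := 30 * s'.reg 0) (T' := 30) (countLabel (e0 ▸ hk)) ?_) (by omega)
    intro s₂ ha₂ h₅
    refine le_time (seq_assign (assign ?_)) (by simp [cost])
    have key := forall_lt_succ_iff
      (fun b => #{p ∈ Ico 1 (s.reg 0) | s.arr 2 (s.arr 1 p) = b} = 1) h₁
    simp only [eval, RamExpr.ne, ha₂.reg 14 (by decide), ha₂.reg 11 (by decide),
      RamState.setReg_reg, if_true, Nat.reduceEqDiff, if_false, key, ← and_assoc, ← h₄]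
    rw [e0, e1, e2] at h₅
    omega
  · simp only [RamState.setReg_reg, if_true, eval, cost]
    generalize s.reg 0 = a at *
    generalize s.reg 6 = b at *
    calc _ ≤ b * (4 + 60 * a) + 4 := by gcongr; omega
      _ ≤ _ := by nlinarith [Nat.mul_le_mul_right b hk]
  · rintro s' ha ⟨⟨h₁, h₂, h₃, h₄⟩, h₅⟩
    have e6 : s'.reg 6 = s.reg 6 := by simpa [ha₁.reg 6 (by decide)] using ha.reg 6 (by decide)
    simp only [eval, e6] at h₅
    refine ⟨h₃, h₄.trans ⟨fun h => ⟨h.1, fun b hb hb' => h.2 b hb (by omega)⟩,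
      fun h => ⟨h.lt, fun b hb hb' => h.card b hb (by omega)⟩⟩⟩
  · simp [cost, eval]
    generalize s.reg 0 = a at *
    generalize s.reg 6 = b at *
    nlinarith [Nat.sub_le a 1]

/-- Counting with carry: the initial block of consecutive entries is reset to `0, 1, …`, which
contributes nothing to the rank, and the next entry is raised by one. If the carry reaches position
`k`, the sequence was the last one. -/
theorem advance (hk : 1 ≤ s.reg 0) (h : Combo (s.reg 0) (s.reg 3) (s.arr 1))
    (h' : s.arr 1 (s.reg 0 + 1) = s.reg 3 + 2) :
    Runs χ advance s (50 * s.reg 0) fun s' => s'.arr 1 0 = s.arr 1 0 ∧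
      s'.arr 1 (s.reg 0 + 1) = s.reg 3 + 2 ∧
      (s'.reg 10 = s.reg 10 ∧ Combo (s.reg 0) (s.reg 3) (s'.arr 1) ∧
        comboRank (s.reg 0) (s'.arr 1) = comboRank (s.reg 0) (s.arr 1) + 1 ∨
      s'.reg 10 = 0 ∧ (s.reg 3).choose (s.reg 0 - 1) = comboRank (s.reg 0) (s.arr 1) + 1) := by
  set k := s.reg 0 with hk0
  set n := s.reg 3 with hn0
  set x := s.arr 1 with hx0
  refine le_time (seq_assign (seq_of (loop
    (fun s' => 1 ≤ s'.reg 8 ∧ s'.reg 8 ≤ k ∧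
      (∀ q, 1 ≤ q → q < s'.reg 8 → s'.arr 1 q = q - 1) ∧
      (∀ q, q = 0 ∨ s'.reg 8 ≤ q → s'.arr 1 q = x q) ∧
      -- The rank still owed after the resets, including the carry. Pascal's rule preserves the
      -- identity, since a reset happens only if the next entry is larger by exactly one.
      ∑ q ∈ Ico (s'.reg 8) k, (x q).choose q + (x (s'.reg 8)).choose (s'.reg 8 - 1) =
        comboRank k x + 1)
    (fun s' => k - s'.reg 8) 25 ?_ ?_) (T' := 20) ?_)) ?_
  · simp [eval, comboRank, hk, hx0]
    omega
  · rintro s' ha ⟨h₁, h₂, h₃, h₄, h₅⟩ hb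
    have e0 : s'.reg 0 = s.reg 0 := by simpa using ha.reg 0 (by decide)
    simp only [eval, h₄ _ (.inr le_rfl), h₄ (s'.reg 8 + 1) (.inr (by omega))] at hb
    have hlt : s'.reg 8 < k := by
      refine lt_of_le_of_ne h₂ fun he => hb ?_
      rw [he, h', h.top, Nat.sub_self]
    have hs : x (s'.reg 8 + 1) = x (s'.reg 8) + 1 := by
      have := h.lt _ h₁ hlt
      omega
    refine le_time (seq_store (assign ?_)) (by simp [cost])
    simp only [eval, RamState.setReg_reg, RamState.setReg_arr, RamState.setArr_arr,
      RamState.setArr_reg, if_true]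
    refine ⟨⟨by omega, by omega, fun q hq hq' => ?_, fun q hq => ?_, ?_⟩, by omega⟩
    · rcases Nat.lt_succ_iff_lt_or_eq.1 hq' with h'' | rfl
      · rw [Function.update_of_ne (by omega), h₃ q hq h'']
      · simp
    · rw [Function.update_of_ne (by omega), h₄ q (by omega)]
    · rw [← h₅, sum_eq_sum_Ico_succ_bot hlt, hs]
      obtain ⟨j, hj⟩ : ∃ j, s'.reg 8 = j + 1 := ⟨s'.reg 8 - 1, by omega⟩
      rw [hj]
      simp only [Nat.add_sub_cancel, Nat.choose_succ_succ (x (j + 1)) j]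
      ring
  · rintro s₁ ha₁ ⟨⟨h₁, h₂, h₃, h₄, h₅⟩, hb⟩
    have e0 : s₁.reg 0 = k := by simpa using ha₁.reg 0 (by decide)
    have e10 : s₁.reg 10 = s.reg 10 := by simpa using ha₁.reg 10 (by decide)
    simp only [eval, h₄ _ (.inr le_rfl), h₄ (s₁.reg 8 + 1) (.inr (by omega))] at hb
    refine le_time (ite (T := 9) (fun hc => le_time (store ?_) (by simp [cost])) fun hc =>
      le_time (assign ?_) (by simp [cost])) (by simp [cost])
    · simp only [eval, e0] at hc
      simp only [eval, RamState.setArr_arr, RamState.setArr_reg, if_true]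
      refine ⟨?_, ?_, .inl ⟨e10, ⟨fun q hq hq' => ?_, ?_⟩, ?_⟩⟩
      · rw [Function.update_of_ne (by omega), h₄ _ (by omega)]
      · rw [Function.update_of_ne (by omega), h₄ _ (by omega), h']
      · have := h.lt q hq hq'
        simp only [Function.update_apply, h₄ _ (.inr le_rfl)]
        rcases lt_trichotomy (q + 1) (s₁.reg 8) with h'' | h'' | h''
        · rw [if_neg (by omega), if_neg (by omega), h₃ _ (by omega) (by omega),
            h₃ _ (by omega) (by omega)]
          omega
        · rw [if_neg (by omega), if_pos h'', h₃ _ (by omega) (by omega), ← h'']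
          have := h.le (p := q + 1) (by omega) (by omega)
          omega
        · rw [if_neg (show q + 1 ≠ s₁.reg 8 by omega)]
          split_ifs with hqe
          · rw [h₄ _ (by omega), ← hqe]
            rw [← hqe] at hb
            omega
          · rw [h₄ _ (by omega), h₄ _ (by omega)]
            omega
      · rw [Function.update_of_ne (by omega), h₄ _ (by omega), h.top]
      · have hlt : s₁.reg 8 < k := by omega
        rw [← h₅, comboRank, ← sum_Ico_consecutive _ h₁ h₂, sum_eq_zero, zero_add,
          sum_eq_sum_Ico_succ_bot hlt, sum_eq_sum_Ico_succ_bot hlt, Function.update_self,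
          h₄ _ (.inr le_rfl)]
        · obtain ⟨j, hj⟩ : ∃ j, s₁.reg 8 = j + 1 := ⟨s₁.reg 8 - 1, by omega⟩
          rw [sum_congr rfl (g := fun q => (x q).choose q)]
          · rw [hj, Nat.choose_succ_succ]
            simp only [Nat.add_sub_cancel]
            ring
          · intro q hq
            rw [mem_Ico] at hq
            rw [Function.update_of_ne (by omega), h₄ _ (by omega)]
        · intro q hq
          rw [mem_Ico] at hq
          rw [Function.update_of_ne (by omega), h₃ _ hq.1 hq.2]
          exact Nat.choose_eq_zero_of_lt (by omega)
    · simp only [eval, e0] at hc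
      have hk' : s₁.reg 8 = k := by omega
      simp only [RamState.setReg_arr, RamState.setReg_reg, if_true, eval]
      refine ⟨h₄ _ (by omega), (h₄ _ (by omega)).trans h', .inr ⟨trivial, ?_⟩⟩
      rw [← h₅, hk', h.top]
      simp
  · simp [cost, eval]
    omega

theorem firstCombo (hk : 1 ≤ s.reg 0) (hn : s.reg 0 ≤ s.reg 3 + 1) :
    Runs χ firstCombo s (60 * s.reg 0) fun s' => s'.arr 1 0 = s.arr 0 (s.reg 5) ∧
      s'.arr 1 (s.reg 0 + 1) = s.reg 3 + 2 ∧ Combo (s.reg 0) (s.reg 3) (s'.arr 1) ∧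
      comboRank (s.reg 0) (s'.arr 1) = 0 ∧ s'.reg 9 = 0 ∧ s'.reg 10 = 1 := by
  refine le_time (seq_store (seq_assign (seq_of (loop
    (fun s' => 1 ≤ s'.reg 8 ∧ s'.reg 8 ≤ s.reg 0 ∧ s'.arr 1 0 = s.arr 0 (s.reg 5) ∧
      (∀ q, 1 ≤ q → q < s'.reg 8 → s'.arr 1 q = q - 1))
    (fun s' => s.reg 0 - s'.reg 8) 25 ?_ ?_) (T' := 30) ?_))) ?_
  · simp [eval, hk]
    omega
  · rintro s' ha ⟨h₁, h₂, h₃, h₄⟩ hb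
    have e0 : s'.reg 0 = s.reg 0 := by simpa using ha.reg 0 (by decide)
    simp only [eval] at hb
    refine le_time (seq_store (assign ?_)) (by simp [cost])
    simp only [eval, RamState.setReg_reg, RamState.setReg_arr, RamState.setArr_arr,
      RamState.setArr_reg, if_true]
    refine ⟨⟨by omega, by omega, ?_, fun q hq hq' => ?_⟩, by omega⟩
    · rw [Function.update_of_ne (by omega), h₃]
    · rcases Nat.lt_succ_iff_lt_or_eq.1 hq' with h'' | rfl
      · rw [Function.update_of_ne (by omega), h₄ q hq h'']
      · simp
  · rintro s₁ ha₁ ⟨⟨h₁, h₂, h₃, h₄⟩, hb⟩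
    have e0 : s₁.reg 0 = s.reg 0 := by simpa using ha₁.reg 0 (by decide)
    have e3 : s₁.reg 3 = s.reg 3 := by simpa using ha₁.reg 3 (by decide)
    simp only [eval] at hb
    refine le_time (seq_store (seq_store (seq_assign (assign ?_)))) (by simp [cost])
    simp only [eval, e0, e3, RamState.setReg_reg, RamState.setReg_arr, RamState.setArr_arr,
      RamState.setArr_reg, if_true, Nat.reduceEqDiff, if_false, and_true, and_self]
    have key : ∀ q, 1 ≤ q → q < s.reg 0 → Function.update (Function.update (s₁.arr 1) (s.reg 0)
        (s.reg 3)) (s.reg 0 + 1) (s.reg 3 + 2) q = q - 1 := by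
      intro q hq hq'
      rw [Function.update_of_ne (by omega), Function.update_of_ne (by omega), h₄ q hq (by omega)]
    refine ⟨?_, by simp, ⟨fun q hq hq' => ?_, ?_⟩, sum_eq_zero fun q hq => ?_⟩
    · rw [Function.update_of_ne (by omega), Function.update_of_ne (by omega), h₃]
    · rw [key q hq hq']
      rcases Nat.lt_or_ge (q + 1) (s.reg 0) with h' | h'
      · rw [key _ (by omega) h']
        omega
      · rw [Function.update_of_ne (by omega), show q + 1 = s.reg 0 by omega, Function.update_self]
        omega
    · rw [Function.update_of_ne (by omega), Function.update_self]
    · rw [mem_Ico] at hq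
      rw [key q hq.1 hq.2]
      exact Nat.choose_eq_zero_of_lt (by omega)
  · simp [cost, eval]
    omega

theorem examine (hk : 1 ≤ s.reg 0) (hks : s.reg 0 = k) (hi : s.reg 6 ≤ k)
    (h9 : s.reg 9 = 0) (h10 : s.reg 10 = 1)
    (h : Combo (s.reg 0) (s.reg 3) (s.arr 1)) (h' : s.arr 1 (s.reg 0 + 1) = s.reg 3 + 2) :
    Runs χ examine s (200 * k * (k + 1)) fun s' => s'.arr 1 0 = s.arr 1 0 ∧
      (s'.reg 9 = 1 ∧ s'.reg 10 = 0 ∧ s'.arr 1 = s.arr 1 ∧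
        Admissible (s.reg 0) (s.reg 6) (s.arr 2) (s.arr 1) ∧
          queriedColor χ (s.arr 1) + 1 = s.reg 6 ∨
      s'.reg 9 = 0 ∧ ¬ (Admissible (s.reg 0) (s.reg 6) (s.arr 2) (s.arr 1) ∧
          queriedColor χ (s.arr 1) + 1 = s.reg 6) ∧
        (s'.reg 10 = 1 ∧ Combo (s.reg 0) (s.reg 3) (s'.arr 1) ∧
          s'.arr 1 (s.reg 0 + 1) = s.reg 3 + 2 ∧
          comboRank (s.reg 0) (s'.arr 1) = comboRank (s.reg 0) (s.arr 1) + 1 ∨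
        s'.reg 10 = 0 ∧ (s.reg 3).choose (s.reg 0 - 1) = comboRank (s.reg 0) (s.arr 1) + 1)) := by
  have hk' : 1 ≤ k := hks ▸ hk
  refine le_time (seq_of (T := 100 * k * (k + 1)) (T' := 80 * k)
    (le_time (checkLabels hk) (by rw [hks]; gcongr)) fun s₁ ha₁ ⟨h₁, h₂⟩ => ?_) (by nlinarith)
  have e0 : s₁.reg 0 = s.reg 0 := ha₁.reg 0 (by decide)
  have e3 : s₁.reg 3 = s.reg 3 := ha₁.reg 3 (by decide)
  have e6 : s₁.reg 6 = s.reg 6 := ha₁.reg 6 (by decide)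
  have e9 : s₁.reg 9 = s.reg 9 := ha₁.reg 9 (by decide)
  have e10 : s₁.reg 10 = s.reg 10 := ha₁.reg 10 (by decide)
  have e1 : s₁.arr 1 = s.arr 1 := ha₁.arr 1 (by decide)
  -- Common end of both failures: labels not admissible, or wrong color.
  have step : ∀ s₂ : RamState, s₂.reg 0 = s.reg 0 → s₂.reg 3 = s.reg 3 → s₂.arr 1 = s.arr 1 →
      s₂.reg 9 = 0 → s₂.reg 10 = 1 →
      ¬ (Admissible (s.reg 0) (s.reg 6) (s.arr 2) (s.arr 1) ∧
          queriedColor χ (s.arr 1) + 1 = s.reg 6) →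
      Runs χ (.ite (reg 9) .skip .advance) s₂ (52 * k) fun s' => s'.arr 1 0 = s.arr 1 0 ∧
      (s'.reg 9 = 1 ∧ s'.reg 10 = 0 ∧ s'.arr 1 = s.arr 1 ∧
        Admissible (s.reg 0) (s.reg 6) (s.arr 2) (s.arr 1) ∧
          queriedColor χ (s.arr 1) + 1 = s.reg 6 ∨
      s'.reg 9 = 0 ∧ ¬ (Admissible (s.reg 0) (s.reg 6) (s.arr 2) (s.arr 1) ∧
          queriedColor χ (s.arr 1) + 1 = s.reg 6) ∧
        (s'.reg 10 = 1 ∧ Combo (s.reg 0) (s.reg 3) (s'.arr 1) ∧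
          s'.arr 1 (s.reg 0 + 1) = s.reg 3 + 2 ∧
          comboRank (s.reg 0) (s'.arr 1) = comboRank (s.reg 0) (s.arr 1) + 1 ∨
        s'.reg 10 = 0 ∧
          (s.reg 3).choose (s.reg 0 - 1) = comboRank (s.reg 0) (s.arr 1) + 1)) := by
    intro s₂ f0 f3 f1 f9 f10 hno
    refine le_time (ite (T := 50 * k) (fun hc => absurd f9 hc) fun hc => ?_) (by simp [cost]; omega)
    have := advance (χ := χ) (s := s₂) (by omega) (by rwa [f0, f3, f1]) (by rw [f0, f3, f1, h'])
    rw [f0, f3, f1, hks] at this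
    rw [hks] at hno ⊢
    refine this.conseq le_rfl fun s₃ ha₃ ⟨g₁, g₂, g₃⟩ => ?_
    have e9 : s₃.reg 9 = 0 := (ha₃.reg 9 (by decide)).trans f9
    refine ⟨g₁, .inr ⟨e9, hno, ?_⟩⟩
    rcases g₃ with ⟨g₃, g₄, g₅⟩ | ⟨g₃, g₄⟩
    · exact .inl ⟨g₃.trans f10, g₄, g₂, g₅⟩
    · exact .inr ⟨g₃, g₄⟩
  refine le_time (seq (T := 2 + (k + 1 + 20)) (T' := 52 * k) ?_) (by omega)
  refine le_time (ite (T := k + 1 + 20) (fun hc => ?_) fun hc => le_time (skip ?_) (by simp))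
    (by simp [cost])
  · simp only [eval] at hc
    have hadm := h₂.1 (by omega)
    refine seq_query (le_time (ite (T := 4) (fun hc' => le_time (skip ?_) (by simp)) fun hc' =>
      le_time (seq_assign (assign ?_)) (by simp [cost])) (by simp [cost]))
    · rw [Ne, eval_ne] at hc'
      simp [eval, e6, e1] at hc'
      apply step <;> simp [*]
    · rw [eval_ne] at hc'
      simp [eval, e6, e1] at hc'
      refine le_time (ite (T := 1) (fun hc => skip ?_) fun hc => ?_) (by simp [cost]; omega)
      · simp [e1, eval, hadm, hc']
      · simp [eval] at hc
  · simp only [eval] at hc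
    exact step s₁ e0 e3 e1 (e9.trans h9) (e10.trans h10) fun h => by
      have := h₂.2 h.1
      omega

/-- The search finds an admissible sequence that gives an edge of the right color if there is
one. -/
theorem search (hk : 1 ≤ s.reg 0) (hks : s.reg 0 = k) (hi : s.reg 6 ≤ k)
    (hn : s.reg 0 ≤ s.reg 3 + 1) :
    Runs χ search s (400 * k * (k + 1) * (s.reg 3).choose (k - 1)) fun s' =>
      s'.arr 1 0 = s.arr 0 (s.reg 5) ∧
      (s'.reg 9 = 1 ∧ Combo (s.reg 0) (s.reg 3) (s'.arr 1) ∧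
        Admissible (s.reg 0) (s.reg 6) (s.arr 2) (s'.arr 1) ∧
        queriedColor χ (s'.arr 1) + 1 = s.reg 6 ∨
      s'.reg 9 = 0 ∧ ∀ y, Combo (s.reg 0) (s.reg 3) y → y 0 = s.arr 0 (s.reg 5) →
        Admissible (s.reg 0) (s.reg 6) (s.arr 2) y → queriedColor χ y + 1 ≠ s.reg 6) := by
  have hpos : 1 ≤ (s.reg 3).choose (k - 1) := Nat.choose_pos (by omega)
  refine le_time (seq_of (T := 60 * k)
    (T' := 250 * k * (k + 1) * (s.reg 3).choose (k - 1) + 2)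
    (le_time (firstCombo hk hn) (by rw [hks])) ?_) ?_
  · rintro s₁ ha₁ ⟨g₁, g₂, g₃, g₄, g₅, g₆⟩
    have e0 : s₁.reg 0 = s.reg 0 := ha₁.reg 0 (by decide)
    have e3 : s₁.reg 3 = s.reg 3 := ha₁.reg 3 (by decide)
    have e6 : s₁.reg 6 = s.reg 6 := ha₁.reg 6 (by decide)
    have e2 : s₁.arr 2 = s.arr 2 := ha₁.arr 2 (by decide)
    refine conseq (loop
      (fun s' => s'.arr 1 0 = s.arr 0 (s.reg 5) ∧
      (s'.reg 10 = 1 ∧ s'.reg 9 = 0 ∧ Combo (s.reg 0) (s.reg 3) (s'.arr 1) ∧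
        s'.arr 1 (s.reg 0 + 1) = s.reg 3 + 2 ∧
        (∀ y, Combo (s.reg 0) (s.reg 3) y → y 0 = s.arr 0 (s.reg 5) →
          Admissible (s.reg 0) (s.reg 6) (s.arr 2) y →
            comboRank (s.reg 0) y < comboRank (s.reg 0) (s'.arr 1) →
            queriedColor χ y + 1 ≠ s.reg 6) ∨
      s'.reg 10 = 0 ∧
      (s'.reg 9 = 1 ∧ Combo (s.reg 0) (s.reg 3) (s'.arr 1) ∧
        Admissible (s.reg 0) (s.reg 6) (s.arr 2) (s'.arr 1) ∧
        queriedColor χ (s'.arr 1) + 1 = s.reg 6 ∨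
      s'.reg 9 = 0 ∧ ∀ y, Combo (s.reg 0) (s.reg 3) y → y 0 = s.arr 0 (s.reg 5) →
        Admissible (s.reg 0) (s.reg 6) (s.arr 2) y → queriedColor χ y + 1 ≠ s.reg 6)))
      -- The number of sequences from the current one onwards; `Combo.rank_lt` keeps it positive
      -- while the search is on.
      (fun s' => if s'.reg 10 = 0 then 0
        else (s.reg 3).choose (k - 1) - comboRank (s.reg 0) (s'.arr 1))
      (200 * k * (k + 1)) ?_ ?_) ?_ ?_
    · exact ⟨g₁, .inl ⟨g₆, g₅, g₃, g₂, fun y _ _ _ hy => by omega⟩⟩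
    · rintro s₂ ha₂ ⟨i₁, i₂⟩ hb
      simp only [eval] at hb
      obtain ⟨f10, f9, i₃, i₄, i₅⟩ := i₂.resolve_right fun h => hb h.1
      have f0 : s₂.reg 0 = s.reg 0 := (ha₂.reg 0 (by decide)).trans e0
      have f3 : s₂.reg 3 = s.reg 3 := (ha₂.reg 3 (by decide)).trans e3
      have f6 : s₂.reg 6 = s.reg 6 := (ha₂.reg 6 (by decide)).trans e6
      have f2 : s₂.arr 2 = s.arr 2 := (ha₂.arr 2 (by decide)).trans e2
      have := examine (χ := χ) (s := s₂) (by omega) (by omega) (by omega) f9 f10 (by rwa [f0, f3])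
        (by rw [f0, f3, i₄])
      rw [f0, f3, f6, f2] at this
      refine this.conseq le_rfl fun s₃ ha₃ ⟨j₁, j₂⟩ => ?_
      have hr : comboRank (s.reg 0) (s₂.arr 1) < (s.reg 3).choose (k - 1) := by
        rw [← hks]
        exact i₃.rank_lt hk
      -- Raising the rank by one adds only the current sequence to those already excluded, since the
      -- rank determines the entries `1, …, k - 1`.
      have hnext : ¬ (Admissible (s.reg 0) (s.reg 6) (s.arr 2) (s₂.arr 1) ∧
            queriedColor χ (s₂.arr 1) + 1 = s.reg 6) →
          ∀ y, Combo (s.reg 0) (s.reg 3) y → y 0 = s.arr 0 (s.reg 5) →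
          Admissible (s.reg 0) (s.reg 6) (s.arr 2) y →
            comboRank (s.reg 0) y < comboRank (s.reg 0) (s₂.arr 1) + 1 →
            queriedColor χ y + 1 ≠ s.reg 6 := by
        intro hno y hy hy0 hya hyr hyc
        rcases Nat.lt_succ_iff_lt_or_eq.1 hyr with h | h
        · exact i₅ y hy hy0 hya h hyc
        · have heq := eq_of_comboRank_eq (fun p hp hp' => hy.lt p hp (by omega))
            (fun p hp hp' => i₃.lt p hp (by omega)) h
          refine hno ⟨hya.congr heq, ?_⟩
          rw [← hyc, queriedColor_congr χ (f := y)]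
          intro p hp
          rcases Nat.eq_zero_or_pos p with rfl | hp'
          · rw [hy0, i₁]
          · exact heq p hp' (by omega)
      rcases j₂ with ⟨j₂, j₃, j₄, j₅, j₆⟩ | ⟨j₂, j₃, ⟨j₄, j₅, j₆, j₇⟩ | ⟨j₄, j₅⟩⟩
      · refine ⟨⟨j₁.trans i₁, .inr ⟨j₃, .inl ⟨j₂, ?_⟩⟩⟩, ?_⟩
        · rw [j₄]
          exact ⟨i₃, j₅, j₆⟩
        · rw [if_pos j₃, if_neg hb]
          omega
      · refine ⟨⟨j₁.trans i₁, .inl ⟨j₄, j₂, j₅, j₆, ?_⟩⟩, ?_⟩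
        · rw [j₇]
          exact hnext j₃
        · rw [if_neg (by omega), if_neg hb]
          omega
      · refine ⟨⟨j₁.trans i₁, .inr ⟨j₄, .inr ⟨j₂, fun y hy hy0 hya => ?_⟩⟩⟩, ?_⟩
        · refine hnext j₃ y hy hy0 hya ?_
          rw [← j₅]
          exact hy.rank_lt hk
        · rw [if_pos j₄, if_neg hb]
          omega
    · simp only [g₆, g₄, cost]
      norm_num
      nlinarith [Nat.mul_le_mul_right (k * (k + 1)) hpos,
        Nat.mul_le_mul_right ((s.reg 3).choose (k - 1)) (show 1 ≤ k * (k + 1) by nlinarith)]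
    · rintro s₂ ha₂ ⟨⟨i₁, i₂⟩, hb⟩
      simp only [eval] at hb
      exact ⟨i₁, (i₂.resolve_left fun h => by omega).2⟩
  · generalize (s.reg 3).choose (k - 1) = C at *
    have : k * 1 ≤ k * C := Nat.mul_le_mul_left _ hpos
    nlinarith [Nat.mul_le_mul_left k this]

end Runs

/-! ### Sequences and edges -/

theorem card_filter_combo {n k : ℕ} {y : ℕ → ℕ} (h : Combo k n y) (P : ℕ → Prop)
    [DecidablePred P] : #{p ∈ Ico 1 k | P (y p)} = #{x ∈ (Ico 1 k).image y | P x} := by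
  rw [filter_image, card_image_of_injOn]
  intro p hp q hq hpq
  simp only [coe_filter, mem_Ico, Set.mem_ofPred_eq] at hp hq
  rcases lt_trichotomy p q with h' | h' | h'
  · exact absurd hpq (h.strictMono hp.1.1 h' hq.1.2.le).ne
  · exact h'
  · exact absurd hpq (h.strictMono hq.1.1 h' hp.1.2.le).ne'

/-- The vertices of an edge other than `v` form an increasing sequence. -/
theorem exists_combo {n k r : ℕ} (hk : 1 ≤ k) (χ : EdgeColoring n k r) (e : CompleteEdge n k)
    {v : Fin n} (hv : v ∈ e.1) : ∃ y, Combo k n y ∧ y 0 = v ∧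
      (Ico 1 k).image y = (e.1.erase v).image Fin.val ∧ queriedColor χ y = χ e := by
  have hc : #(e.1.erase v) = k - 1 := by rw [card_erase_of_mem hv, e.2]
  set o := (e.1.erase v).orderEmbOfFin hc with ho
  have hor : ∀ x, x ∈ e.1.erase v ↔ ∃ p, o p = x := by
    intro x
    rw [← mem_coe, ← range_orderEmbOfFin _ hc, Set.mem_range]
  let y : ℕ → ℕ := fun p => if p = 0 then v else if h : p - 1 < k - 1 then o ⟨p - 1, h⟩ else n
  have hy : ∀ p (_ : 1 ≤ p) (h : p < k), y p = o ⟨p - 1, by omega⟩ := by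
    intro p hp h
    simp only [y]
    rw [if_neg (by omega), dif_pos (by omega)]
  have hyk : y k = n := by
    simp only [y]
    rw [if_neg (by omega), dif_neg (by omega)]
  have himg : (Ico 1 k).image y = (e.1.erase v).image Fin.val := by
    ext x
    simp only [mem_image, mem_Ico, hor]
    constructor
    · rintro ⟨p, ⟨hp, hp'⟩, rfl⟩
      exact ⟨_, ⟨_, rfl⟩, (hy p hp hp').symm⟩
    · rintro ⟨_, ⟨p, rfl⟩, rfl⟩
      refine ⟨p + 1, ⟨by omega, by omega⟩, ?_⟩
      rw [hy _ (by omega) (by omega)]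
      rfl
  refine ⟨y, ⟨fun p hp hp' => ?_, hyk⟩, rfl, himg, ?_⟩
  · rw [hy p hp hp']
    rcases Nat.lt_or_ge (p + 1) k with h | h
    · rw [hy _ (by omega) h]
      exact o.strictMono (Fin.mk_lt_mk.2 (by omega))
    · rw [show p + 1 = k by omega, hyk]
      exact Fin.is_lt _
  · have : listedVertices n k y = e.1 := by
      ext x
      simp only [listedVertices, mem_filter, mem_univ, true_and]
      constructor
      · rintro ⟨p, hp, hpx⟩
        rcases Nat.eq_zero_or_pos p with rfl | hp'
        · rwa [← Fin.ext (show (v : ℕ) = x from hpx)]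
        · have : y p ∈ (Ico 1 k).image y := mem_image_of_mem _ (mem_Ico.2 ⟨hp', hp⟩)
          rw [himg, hpx, mem_image] at this
          obtain ⟨z, hz, hzx⟩ := this
          rw [← Fin.ext hzx]
          exact mem_of_mem_erase hz
      · intro hx
        rcases eq_or_ne x v with rfl | hxv
        · exact ⟨0, hk, rfl⟩
        · have : (x : ℕ) ∈ (Ico 1 k).image y := by
            rw [himg]
            exact mem_image_of_mem _ (mem_erase.2 ⟨hxv, hx⟩)
          obtain ⟨p, hp, hpx⟩ := mem_image.1 this
          exact ⟨p, (mem_Ico.1 hp).2, hpx⟩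
    have hcard : #(listedVertices n k y) = k := by rw [this, e.2]
    rw [queriedColor, dif_pos hcard]
    congr

/-- The `k - 1` positions split into label classes; the `i - 1` nonzero labels take one each and
leave `k - i` for the label `0`. For `k = 0` there are no positions to count. -/
theorem Admissible.card_zero {k i : ℕ} {lab y : ℕ → ℕ} (hi : 1 ≤ i)
    (h : Admissible k i lab y) : #{p ∈ Ico 1 k | lab (y p) = 0} + i = k ∨ k = 0 := by
  have h₁ := card_eq_sum_card_fiberwise (s := Ico 1 k) (t := range i) (f := fun p => lab (y p))
    fun p hp => by
      rw [mem_coe, mem_Ico] at hp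
      exact mem_range.2 (h.lt p hp.1 hp.2)
  rw [range_eq_Ico, sum_eq_sum_Ico_succ_bot (by omega), sum_congr rfl (g := fun _ => 1)] at h₁
  · simp at h₁
    omega
  · intro b hb
    rw [mem_Ico] at hb
    exact h.card b hb.1 hb.2

/-! ### The invariant of the depth-first search

A vertex has the label `0` if it is unused, `a` with `1 ≤ a ≤ r` if it was discarded in stage `a`,
`r + 1 + a` if it was put on the path in stage `a`, when it was unused, and `r + 1` if it
was put on the path after it had been discarded in an earlier stage. -/

/-- The class of the vertices with label `c` from the point of view of stage `a`:
discarded vertices have the number of the stage, vertices that were still unused at the end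
of stage `a` have the class `0`, and `r + 1` stands for all other vertices. -/
def labelClass (r a c : ℕ) : ℕ :=
  if c ≤ a then c else if c ≤ r ∨ r + 1 + a < c then 0 else r + 1

/-- The edge `e` contains exactly one vertex of each of the classes `1, …, a`, and its other
vertices have class `0`. -/
structure Transversal {n : ℕ} (r a : ℕ) (lab : ℕ → ℕ) (e : Finset (Fin n)) : Prop where
  le : ∀ x ∈ e, labelClass r a (lab x) ≤ a
  card : ∀ b, 1 ≤ b → b ≤ a → #{x ∈ e | labelClass r a (lab (x : Fin n)) = b} = 1

/-- How forbidden edges are carried through a relabeling: a label change is harmless if it keeps the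
class or moves the vertex to a class beyond `a`, which no transversal edge meets. -/
theorem Transversal.mono {n r a : ℕ} {lab lab' : ℕ → ℕ} {e : Finset (Fin n)}
    (h : Transversal r a lab' e) (hl : ∀ x ∈ e, labelClass r a (lab' x) ≤ a →
      labelClass r a (lab x) = labelClass r a (lab' x)) : Transversal r a lab e := by
  refine ⟨fun x hx => (hl x hx (h.le x hx)).trans_le (h.le x hx), fun b hb hb' => ?_⟩
  refine Eq.trans (congrArg Finset.card (filter_congr fun x hx => ?_)) (h.card b hb hb')
  rw [hl x hx (h.le x hx)]

/-- The number of vertices with label `a`. -/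
def classCount (n : ℕ) (lab : ℕ → ℕ) (a : ℕ) : ℕ := #{x ∈ range n | lab x = a}

/-- The number of indices up to `N` for which the path vertex has label `c`. -/
def pathCount (N : ℕ) (f lab : ℕ → ℕ) (c : ℕ) : ℕ := #{p ∈ range (N + 1) | lab (f p) = c}

theorem pathCount_zero_le (f lab : ℕ → ℕ) (c : ℕ) : pathCount 0 f lab c ≤ 1 :=
  (card_filter_le _ _).trans (by simp)

theorem pathCount_mono {N N' : ℕ} (h : N ≤ N') (f lab : ℕ → ℕ) (c : ℕ) :
    pathCount N f lab c ≤ pathCount N' f lab c :=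
  card_le_card (filter_subset_filter _ (range_subset_range.2 (by omega)))

theorem pathCount_congr {N c : ℕ} {f lab f' lab' : ℕ → ℕ}
    (h : ∀ p ≤ N, (lab (f p) = c ↔ lab' (f' p) = c)) :
    pathCount N f lab c = pathCount N f' lab' c := by
  refine congrArg card (filter_congr fun p hp => h p ?_)
  rw [mem_range] at hp
  omega

theorem pathCount_add (N j : ℕ) (f lab : ℕ → ℕ) (c : ℕ) :
    pathCount (N + j) f lab c = pathCount N f lab c + #{p ∈ Ico 1 (j + 1) | lab (f (N + p)) = c} := by
  simp only [pathCount, card_filter]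
  rw [show N + j + 1 = N + 1 + j by omega, sum_range_add, sum_Ico_eq_sum_range]
  simp only [add_assoc, Nat.add_sub_cancel]

theorem pathCount_swap {f lab : ℕ → ℕ} {q N : ℕ} (hq : q ≤ N) (c : ℕ) :
    pathCount N (fun p => f (Equiv.swap q N p)) lab c = pathCount N f lab c := by
  have hle : ∀ p ≤ N, Equiv.swap q N p ≤ N := by
    intro p hp
    rw [Equiv.swap_apply_def]
    split_ifs <;> omega
  refine card_bij (fun p _ => Equiv.swap q N p) ?_ ?_ ?_
  · intro p hp
    rw [mem_filter, mem_range] at hp ⊢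
    have := hle p (by omega)
    exact ⟨by omega, hp.2⟩
  · intro p _ p' _ hpp
    exact (Equiv.swap q N).injective hpp
  · intro p hp
    rw [mem_filter, mem_range] at hp
    have := hle p (by omega)
    exact ⟨Equiv.swap q N p, by simpa using ⟨by omega, hp.2⟩, by simp⟩

theorem classCount_update {n x a : ℕ} {lab : ℕ → ℕ} (hx : x < n) (b : ℕ) :
    classCount n (Function.update lab x b) a + (if lab x = a then 1 else 0) =
      classCount n lab a + if b = a then 1 else 0 := by
  simp only [classCount, card_filter]
  rw [← add_sum_erase _ _ (mem_range.2 hx),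
    ← add_sum_erase (range n) (fun y => if lab y = a then 1 else 0) (mem_range.2 hx),
    Function.update_self,
    sum_congr rfl (g := fun y => if lab y = a then 1 else 0)]
  · ring
  · intro y hy
    rw [Function.update_of_ne (ne_of_mem_erase hy)]

/-- `d a` is the number of vertices that are to be discarded in stage `a`. -/
structure Thresholds (k ℓ r n : ℕ) (d : ℕ → ℕ) : Prop where
  one_le_r : 1 ≤ r
  r_lt : r < k
  one_le_ℓ : 1 ≤ ℓ
  last : d r = 1
  step : ∀ a, 1 ≤ a → a < r → d a = d (a + 1) + d (a + 1) / (k - (a + 1)) + ℓ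
  sum_le : ∑ a ∈ Ico 1 (r + 1), d a + r * (k * ℓ) ≤ n

/-- The invariant of the search: in stage `i`, the path `f` has `m` edges of color `i - 1`, and `cnt`
vertices have been discarded. -/
structure SearchInv {n k r : ℕ} (χ : EdgeColoring n k r) (ℓ : ℕ) (d : ℕ → ℕ) (i m cnt : ℕ)
    (f lab : ℕ → ℕ) : Prop where
  one_le : 1 ≤ i
  le_r : i ≤ r
  le_ℓ : m ≤ ℓ
  lt : ∀ p ≤ m * (k - 1), f p < n
  inj : ∀ p ≤ m * (k - 1), ∀ q ≤ m * (k - 1), f p = f q → p = q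
  label : ∀ x, lab x ≤ i ∨ r + 1 ≤ lab x ∧ lab x ≤ r + 1 + i
  -- Makes path vertices ineligible for extensions, whose labels are below `i`. For `m = 0` the
  -- entry `f 0` may be left over from an earlier stage.
  label_path : 0 < m → ∀ p ≤ m * (k - 1), i ≤ lab (f p)
  joint : ∀ b < m, lab (f (b * (k - 1))) = r + 1 + i
  color : ∀ b < m, queriedColor χ (fun q => f (b * (k - 1) + q)) + 1 = i
  -- The `1` is the root. The bound is required for all prefixes because dropping edges leads back
  -- to them.
  live : ∀ b ≤ m, pathCount (b * (k - 1)) f lab (r + 1 + i) ≤ (k - i) * b + 1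
  -- Each vertex taken from class `a` in this stage is paid for by `k - i` vertices that are now
  -- discarded or live on the path.
  discarded : ∀ a, 1 ≤ a → a < i →
    (k - i) * d (i - 1) ≤ (k - i) * classCount n lab a + cnt +
      pathCount (m * (k - 1)) f lab (r + 1 + i)
  -- An unused vertex first becomes live; it is then discarded, still live on the path, or among the
  -- at most `k * ℓ` live ones given up at the end of an earlier stage.
  unused : n ≤ classCount n lab 0 + ∑ a ∈ Ico 1 i, d a + (i - 1) * (k * ℓ) + cnt +
      pathCount (m * (k - 1)) f lab (r + 1 + i)
  cnt_le : cnt ≤ classCount n lab i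
  edges : ∀ a, 1 ≤ a → a ≤ i → ∀ e : CompleteEdge n k, Transversal r a lab e.1 → (χ e : ℕ) + 1 ≠ a

namespace Thresholds

variable {k ℓ r n : ℕ} {d : ℕ → ℕ}

theorem pos (h : Thresholds k ℓ r n d) {a : ℕ} (ha : 1 ≤ a) (har : a ≤ r) : 1 ≤ d a := by
  rcases har.eq_or_lt with rfl | har
  · exact h.last.ge
  · rw [h.step a ha har]
    exact h.one_le_ℓ.trans (Nat.le_add_left _ _)

theorem sum_mono {i j : ℕ} (hij : i ≤ j) :
    ∑ a ∈ Ico 1 i, d a ≤ ∑ a ∈ Ico 1 j, d a :=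
  sum_le_sum_of_subset (Ico_subset_Ico le_rfl hij)

end Thresholds

/-! ### Initial state, new roots and backtracking -/

namespace SearchInv

variable {n k r ℓ i m cnt : ℕ} {χ : EdgeColoring n k r} {d f lab : ℕ → ℕ}

theorem init (hd : Thresholds k ℓ r n d) : SearchInv χ ℓ d 1 0 0 (fun _ => 0) (fun _ => 0) where
  one_le := le_rfl
  le_r := hd.one_le_r
  le_ℓ := Nat.zero_le _
  lt p _ := by
    have h₁ := hd.sum_le
    have h₂ := Nat.mul_pos hd.one_le_r
      (Nat.mul_pos (show 0 < k from by have := hd.r_lt; omega) hd.one_le_ℓ)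
    show 0 < n
    omega
  inj := by simp
  label := by simp
  label_path := by simp
  joint := by simp
  color := by simp
  live := by
    intro b hb
    obtain rfl : b = 0 := by omega
    rw [zero_mul]
    exact (pathCount_zero_le _ _ _).trans (by omega)
  discarded := by omega
  unused := by simp [classCount]
  cnt_le := Nat.zero_le _
  edges a ha ha' e he := by
    have := he.card 1 le_rfl ha
    simp [labelClass] at this

/-- Without a live root, `unused` charges all missing vertices to discards and earlier stages; as
`cnt < d i`, this is less than `n`. -/
theorem exists_unused (hd : Thresholds k ℓ r n d) (h : SearchInv χ ℓ d i 0 cnt f lab)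
    (hf : lab (f 0) ≠ r + 1 + i) (hcnt : cnt < d i) : ∃ x < n, lab x = 0 := by
  have h₁ : pathCount 0 f lab (r + 1 + i) = 0 := by simp [pathCount, hf]
  have h₂ := h.unused
  have h₃ := hd.sum_le
  have h₄ := Thresholds.sum_mono (d := d) (show i + 1 ≤ r + 1 by have := h.le_r; omega)
  have h₅ : (i - 1) * (k * ℓ) + 1 ≤ r * (k * ℓ) := by
    have h₆ : 0 < k * ℓ := Nat.mul_pos (by have := hd.r_lt; omega) hd.one_le_ℓ
    have h₇ : i - 1 + 1 ≤ r := by have := h.le_r; have := h.one_le; omega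
    have := Nat.mul_le_mul_right (k * ℓ) h₇
    rw [add_one_mul] at this
    omega
  rw [zero_mul, h₁] at h₂
  rw [sum_Ico_succ_top h.one_le] at h₄
  have h₈ : 0 < classCount n lab 0 := by omega
  obtain ⟨x, hx⟩ := card_pos.1 h₈
  rw [mem_filter, mem_range] at hx
  exact ⟨x, hx⟩

theorem newRoot (h : SearchInv χ ℓ d i 0 cnt f lab) (hf : lab (f 0) ≠ r + 1 + i) {x : ℕ}
    (hx : x < n) (hx0 : lab x = 0) :
    SearchInv χ ℓ d i 0 cnt (Function.update f 0 x) (Function.update lab x (r + 1 + i)) where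
  one_le := h.one_le
  le_r := h.le_r
  le_ℓ := h.le_ℓ
  lt p hp := by
    obtain rfl : p = 0 := by omega
    simpa
  inj := by simp
  label y := by
    rcases eq_or_ne y x with rfl | hy
    · simp
    · rw [Function.update_of_ne hy]
      exact h.label y
  label_path := by simp
  joint := by simp
  color := by simp
  live b hb := by
    obtain rfl : b = 0 := by omega
    rw [zero_mul]
    exact (pathCount_zero_le _ _ _).trans (by omega)
  discarded a ha ha' := by
    have h₁ := h.discarded a ha ha'
    have h₂ := classCount_update (lab := lab) (a := a) hx (r + 1 + i)
    have h₃ := pathCount_zero_le f lab (r + 1 + i)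
    rw [if_neg (by omega), if_neg (by omega)] at h₂
    have h₄ : pathCount (0 * (k - 1)) f lab (r + 1 + i) = 0 := by simp [pathCount, hf]
    rw [add_zero, add_zero] at h₂
    rw [h₂]
    omega
  unused := by
    have h₁ := h.unused
    have h₂ := classCount_update (lab := lab) (a := 0) hx (r + 1 + i)
    rw [if_pos hx0, if_neg (by omega)] at h₂
    have h₄ : pathCount (0 * (k - 1)) f lab (r + 1 + i) = 0 := by simp [pathCount, hf]
    have h₅ : pathCount (0 * (k - 1)) (Function.update f 0 x) (Function.update lab x (r + 1 + i))
      (r + 1 + i) = 1 := by simp [pathCount, filter_singleton]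
    omega
  cnt_le := by
    have h₁ := h.cnt_le
    have h₂ := classCount_update (lab := lab) (a := i) hx (r + 1 + i)
    have := h.one_le
    rw [if_neg (by omega), if_neg (by omega)] at h₂
    omega
  edges a ha ha' e he := by
    refine h.edges a ha ha' e (he.mono fun y _ hy => ?_)
    rcases eq_or_ne (y : ℕ) x with hyx | hyx
    · rw [hyx, Function.update_self] at hy ⊢
      have := h.le_r
      rw [hx0]
      simp only [labelClass] at hy ⊢
      split_ifs at hy ⊢ <;> omega
    · rw [Function.update_of_ne hyx]

/-- The vertices removed are not live, so the live count in the accounting does not change. -/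
theorem pop (h : SearchInv χ ℓ d i (m + 1) cnt f lab)
    (hf : ∀ p, m * (k - 1) < p → p ≤ (m + 1) * (k - 1) → lab (f p) ≠ r + 1 + i) :
    SearchInv χ ℓ d i m cnt f lab := by
  have hm : m * (k - 1) ≤ (m + 1) * (k - 1) := Nat.mul_le_mul_right _ (Nat.le_succ m)
  have hL : pathCount ((m + 1) * (k - 1)) f lab (r + 1 + i) =
      pathCount (m * (k - 1)) f lab (r + 1 + i) := by
    rw [add_one_mul, pathCount_add, filter_eq_empty_iff.2, card_empty, add_zero]
    intro p hp
    rw [mem_Ico] at hp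
    exact hf _ (by omega) (by rw [add_one_mul]; omega)
  exact
  { one_le := h.one_le
    le_r := h.le_r
    le_ℓ := (Nat.le_succ m).trans h.le_ℓ
    lt := fun p hp => h.lt p (hp.trans hm)
    inj := fun p hp q hq => h.inj p (hp.trans hm) q (hq.trans hm)
    label := h.label
    label_path := fun _ p hp => h.label_path (Nat.succ_pos m) p (hp.trans hm)
    joint := fun b hb => h.joint b (by omega)
    color := fun b hb => h.color b (by omega)
    live := fun b hb => h.live b (by omega)
    discarded := fun a ha ha' => hL ▸ h.discarded a ha ha'
    unused := hL ▸ h.unused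
    cnt_le := h.cnt_le
    edges := h.edges }

/-- The vertices of the last edge other than its first one are interchangeable: the edge stays the
same set, and all joints precede `q`. -/
theorem swap (h : SearchInv χ ℓ d i (m + 1) cnt f lab) {q : ℕ} (hq : m * (k - 1) < q)
    (hq' : q ≤ (m + 1) * (k - 1)) :
    SearchInv χ ℓ d i (m + 1) cnt (fun p => f (Equiv.swap q ((m + 1) * (k - 1)) p)) lab := by
  set N := (m + 1) * (k - 1) with hN
  have hN' : N = m * (k - 1) + (k - 1) := add_one_mul _ _
  have hle : ∀ p ≤ N, Equiv.swap q N p ≤ N := by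
    intro p hp
    rw [Equiv.swap_apply_def]
    split_ifs <;> omega
  have hfix : ∀ p < q, Equiv.swap q N p = p := fun p hp =>
    Equiv.swap_apply_of_ne_of_ne (by omega) (by omega)
  have hb : ∀ b < m + 1, b * (k - 1) < q := fun b hb =>
    (Nat.mul_le_mul_right (k - 1) (Nat.lt_succ_iff.1 hb)).trans_lt hq
  have hL := pathCount_swap (f := f) (lab := lab) hq' (r + 1 + i)
  exact
  { one_le := h.one_le
    le_r := h.le_r
    le_ℓ := h.le_ℓ
    lt := fun p hp => h.lt _ (hle p hp)
    inj := fun p hp p' hp' hpp => (Equiv.swap q N).injective (h.inj _ (hle p hp) _ (hle p' hp') hpp)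
    label := h.label
    label_path := fun hm p hp => h.label_path hm _ (hle p hp)
    joint := fun b hb' => by
      rw [hfix _ (hb b hb')]
      exact h.joint b hb'
    color := fun b hb' => by
      rw [← h.color b hb', Nat.add_right_cancel_iff]
      rcases Nat.lt_succ_iff_lt_or_eq.1 hb' with hb'' | rfl
      · refine queriedColor_congr χ fun p hp => ?_
        have := Nat.mul_le_mul_right (k - 1) (Nat.succ_le_of_lt hb'')
        rw [Nat.succ_mul] at this
        rw [hfix _ (by omega)]
      · have hrange : ∀ p < k, ∃ p' < k, Equiv.swap q N (b * (k - 1) + p) = b * (k - 1) + p' := by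
          intro p hp
          refine ⟨Equiv.swap q N (b * (k - 1) + p) - b * (k - 1), ?_⟩
          rw [Equiv.swap_apply_def]
          split_ifs <;> omega
        have : listedVertices n k (fun p => f (Equiv.swap q N (b * (k - 1) + p))) =
            listedVertices n k fun p => f (b * (k - 1) + p) := by
          ext v
          simp only [listedVertices, mem_filter, mem_univ, true_and]
          constructor
          · rintro ⟨p, hp, hpv⟩
            obtain ⟨p', hp', hpp⟩ := hrange p hp
            exact ⟨p', hp', hpp ▸ hpv⟩
          · rintro ⟨p, hp, hpv⟩
            obtain ⟨p', hp', hpp⟩ := hrange p hp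
            exact ⟨p', hp', by rw [← hpp, Equiv.swap_apply_self]; exact hpv⟩
        simp only [queriedColor, this]
    live := fun b hb' => by
      rcases hb'.lt_or_eq with hb' | rfl
      · rw [pathCount_congr (f' := f) (lab' := lab)]
        · exact h.live b hb'.le
        · intro p hp
          rw [hfix p (hp.trans_lt (hb b hb'))]
      · rw [hL]
        exact h.live _ le_rfl
    discarded := fun a ha ha' => hL ▸ h.discarded a ha ha'
    unused := hL ▸ h.unused
    cnt_le := h.cnt_le
    edges := h.edges }

end SearchInv

/-- A quantity that decreases in every round of the search. -/
def searchPotential (k n r i m : ℕ) (f lab : ℕ → ℕ) : ℕ :=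
  -- An extension gains `3 * (k - i)` and loses at most `2` through the new edge and a non-live end.
  -- A discard gains `2` and loses at most `1`, even if a new stage follows. A swap makes the end
  -- live, and dropping an edge ends at a live joint.
  5 * classCount n lab 0 + 2 * pathCount (m * (k - 1)) f lab (r + 1 + i) + m +
    if lab (f (m * (k - 1))) = r + 1 + i then 0 else 1

/-- The path `f` with last index `N` is extended by the vertices `y 1, …, y (k - 1)`. -/
structure PathExtension (k n r i N : ℕ) (f lab y f' lab' : ℕ → ℕ) : Prop where
  combo : Combo k n y
  admissible : Admissible k i lab y
  zero : y 0 = f N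
  path_old : ∀ p ≤ N, f' p = f p
  path_new : ∀ q, 1 ≤ q → q < k → f' (N + q) = y q
  label_new : ∀ q, 1 ≤ q → q < k → lab' (y q) = if lab (y q) = 0 then r + 1 + i else r + 1
  label_old : ∀ x, (∀ q, 1 ≤ q → q < k → x ≠ y q) → lab' x = lab x

theorem PathExtension.classCount_eq {k n r i N : ℕ} {f lab y f' lab' : ℕ → ℕ}
    (h : PathExtension k n r i N f lab y f' lab') {a : ℕ} (ha : a ≤ r) :
    classCount n lab' a + #{p ∈ Ico 1 k | lab (y p) = a} = classCount n lab a := by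
  rw [card_filter_combo h.combo (fun x => lab x = a)]
  have hnew : ∀ x ∈ (Ico 1 k).image y, x < n ∧ lab' x ≠ a := by
    intro x hx
    obtain ⟨q, hq, rfl⟩ := mem_image.1 hx
    rw [mem_Ico] at hq
    refine ⟨h.combo.lt_top hq.1 hq.2, ?_⟩
    rw [h.label_new q hq.1 hq.2]
    split_ifs <;> omega
  have hold : ∀ x, x ∉ (Ico 1 k).image y → lab' x = lab x := by
    intro x hx
    refine h.label_old x fun q hq hq' he => hx ?_
    exact mem_image.2 ⟨q, mem_Ico.2 ⟨hq, hq'⟩, he.symm⟩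
  rw [classCount, classCount, ← card_union_of_disjoint]
  · congr 1
    ext x
    simp only [mem_union, mem_filter, mem_range]
    by_cases hx : x ∈ (Ico 1 k).image y
    · have := hnew x hx
      tauto
    · have := hold x hx
      rw [this]
      tauto
  · rw [disjoint_left]
    intro x hx hx'
    rw [mem_filter] at hx hx'
    exact (hnew x hx'.1).2 hx.2

/-! ### Extending, discarding and changing the stage -/

namespace SearchInv

variable {n k r ℓ i m cnt : ℕ} {χ : EdgeColoring n k r} {d f lab : ℕ → ℕ}

theorem newRoot_potential (hf : lab (f 0) ≠ r + 1 + i) {x : ℕ} (hx : x < n) (hx0 : lab x = 0) :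
    searchPotential k n r i 0 (Function.update f 0 x) (Function.update lab x (r + 1 + i)) <
      searchPotential k n r i 0 f lab := by
  have h₂ := classCount_update (lab := lab) (a := 0) hx (r + 1 + i)
  rw [if_pos hx0, if_neg (by omega)] at h₂
  have h₅ := pathCount_zero_le (Function.update f 0 x) (Function.update lab x (r + 1 + i))
    (r + 1 + i)
  simp only [searchPotential, zero_mul, Function.update_self, if_true, if_neg hf]
  omega

theorem swap_potential (hf : lab (f (m * (k - 1))) ≠ r + 1 + i) {q : ℕ}
    (hq' : q ≤ m * (k - 1)) (hq : lab (f q) = r + 1 + i) :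
    searchPotential k n r i m (fun p => f (Equiv.swap q (m * (k - 1)) p)) lab <
      searchPotential k n r i m f lab := by
  simp only [searchPotential, pathCount_swap hq', Equiv.swap_apply_right, hq, if_true, if_neg hf]
  omega

theorem pop_potential (h : SearchInv χ ℓ d i (m + 1) cnt f lab) :
    searchPotential k n r i m f lab < searchPotential k n r i (m + 1) f lab := by
  have hm : m * (k - 1) ≤ (m + 1) * (k - 1) := Nat.mul_le_mul_right _ (Nat.le_succ m)
  have := pathCount_mono hm f lab (r + 1 + i)
  simp only [searchPotential, h.joint m (Nat.lt_succ_self m), if_true]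
  omega

section Extend

variable {y f' lab' : ℕ → ℕ}

theorem old_ne_new (h : SearchInv χ ℓ d i m cnt f lab)
    (hv : lab (f (m * (k - 1))) = r + 1 + i)
    (he : PathExtension k n r i (m * (k - 1)) f lab y f' lab') {p q : ℕ} (hp : p ≤ m * (k - 1))
    (hq : 1 ≤ q) (hq' : q < k) : f p ≠ y q := by
  intro heq
  have h₁ := he.admissible.lt q hq hq'
  rw [← heq] at h₁
  rcases Nat.eq_zero_or_pos m with rfl | hm
  · obtain rfl : p = 0 := by omega
    rw [zero_mul] at hv
    omega
  · have := h.label_path hm p hp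
    omega

theorem label_old (h : SearchInv χ ℓ d i m cnt f lab)
    (hv : lab (f (m * (k - 1))) = r + 1 + i)
    (he : PathExtension k n r i (m * (k - 1)) f lab y f' lab') {p : ℕ} (hp : p ≤ m * (k - 1)) :
    lab' (f' p) = lab (f p) := by
  rw [he.path_old p hp]
  exact he.label_old _ fun q hq hq' => old_ne_new h hv he hp hq hq'

theorem extend_pathCount (hk : 1 ≤ k) (h : SearchInv χ ℓ d i m cnt f lab)
    (hv : lab (f (m * (k - 1))) = r + 1 + i)
    (he : PathExtension k n r i (m * (k - 1)) f lab y f' lab') :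
    pathCount ((m + 1) * (k - 1)) f' lab' (r + 1 + i) =
      pathCount (m * (k - 1)) f lab (r + 1 + i) + (k - i) := by
  have h₀ := he.admissible.card_zero h.one_le
  rw [add_one_mul, pathCount_add, Nat.sub_add_cancel hk]
  congr 1
  · exact pathCount_congr fun p hp => by rw [label_old h hv he hp]
  · rw [show k - i = #{p ∈ Ico 1 k | lab (y p) = 0} by omega]
    refine congrArg card (filter_congr fun p hp => ?_)
    rw [mem_Ico] at hp
    rw [he.path_new p hp.1 hp.2, he.label_new p hp.1 hp.2]
    have := h.one_le
    split_ifs with h'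
    · simp [h']
    · simp [h']
      omega

/-- The accounting balances: each earlier class loses one vertex, the unused vertices become `k - i`
live ones. Old candidates stay excluded: a used vertex keeps its class for stage `a` or gets the
class `r + 1`. -/
theorem extend (hk : 1 ≤ k) (h : SearchInv χ ℓ d i m cnt f lab)
    (hv : lab (f (m * (k - 1))) = r + 1 + i)
    (he : PathExtension k n r i (m * (k - 1)) f lab y f' lab') (hm : m < ℓ)
    (hc : queriedColor χ y + 1 = i) : SearchInv χ ℓ d i (m + 1) cnt f' lab' := by
  have hN : (m + 1) * (k - 1) = m * (k - 1) + (k - 1) := add_one_mul _ _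
  have hi := h.one_le
  have hir := h.le_r
  have hL := extend_pathCount hk h hv he
  have hsplit : ∀ p ≤ (m + 1) * (k - 1), p ≤ m * (k - 1) ∨
      ∃ q, 1 ≤ q ∧ q < k ∧ p = m * (k - 1) + q := by
    intro p hp
    rcases Nat.lt_or_ge (m * (k - 1)) p with h' | h'
    · exact .inr ⟨p - m * (k - 1), by omega, by omega, by omega⟩
    · exact .inl h'
  have hb : ∀ b ≤ m, b * (k - 1) ≤ m * (k - 1) := fun b hb => Nat.mul_le_mul_right _ hb
  exact
  { one_le := hi
    le_r := hir
    le_ℓ := hm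
    lt := fun p hp => by
      rcases hsplit p hp with h' | ⟨q, hq, hq', rfl⟩
      · rw [he.path_old p h']
        exact h.lt p h'
      · rw [he.path_new q hq hq']
        exact he.combo.lt_top hq hq'
    inj := fun p hp p' hp' hpp => by
      rcases hsplit p hp with h₁ | ⟨q, hq, hq', rfl⟩ <;>
        rcases hsplit p' hp' with h₂ | ⟨q', hqq, hqq', rfl⟩
      · rw [he.path_old p h₁, he.path_old p' h₂] at hpp
        exact h.inj p h₁ p' h₂ hpp
      · rw [he.path_old p h₁, he.path_new q' hqq hqq'] at hpp
        exact absurd hpp (old_ne_new h hv he h₁ hqq hqq')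
      · rw [he.path_old p' h₂, he.path_new q hq hq'] at hpp
        exact absurd hpp.symm (old_ne_new h hv he h₂ hq hq')
      · rw [he.path_new q hq hq', he.path_new q' hqq hqq'] at hpp
        rcases lt_trichotomy q q' with h' | h' | h'
        · exact absurd hpp (he.combo.strictMono hq h' hqq'.le).ne
        · rw [h']
        · exact absurd hpp (he.combo.strictMono hqq h' hq'.le).ne'
    label := fun x => by
      by_cases hx : ∃ q, 1 ≤ q ∧ q < k ∧ x = y q
      · obtain ⟨q, hq, hq', rfl⟩ := hx
        rw [he.label_new q hq hq']
        split_ifs <;> omega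
      · push Not at hx
        rw [he.label_old x hx]
        exact h.label x
    label_path := fun _ p hp => by
      rcases hsplit p hp with h' | ⟨q, hq, hq', rfl⟩
      · rw [label_old h hv he h']
        rcases Nat.eq_zero_or_pos m with rfl | hm
        · obtain rfl : p = 0 := by omega
          rw [zero_mul] at hv
          omega
        · exact h.label_path hm p h'
      · rw [he.path_new q hq hq', he.label_new q hq hq']
        split_ifs <;> omega
    joint := fun b hb' => by
      rw [label_old h hv he (hb b (by omega))]
      rcases Nat.lt_succ_iff_lt_or_eq.1 hb' with h' | rfl
      · exact h.joint b h'
      · exact hv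
    color := fun b hb' => by
      rcases Nat.lt_succ_iff_lt_or_eq.1 hb' with h' | rfl
      · rw [← h.color b h', queriedColor_congr χ]
        intro p hp
        have := Nat.mul_le_mul_right (k - 1) (Nat.succ_le_of_lt h')
        rw [Nat.succ_mul] at this
        exact he.path_old _ (by omega)
      · rw [← hc, queriedColor_congr χ]
        intro p hp
        rcases Nat.eq_zero_or_pos p with rfl | hp'
        · rw [add_zero, he.path_old _ le_rfl, he.zero]
        · exact he.path_new p hp' hp
    live := fun b hb' => by
      rcases Nat.le_succ_iff.1 hb' with h' | rfl
      · rw [← pathCount_congr (f := f) (lab := lab) fun p hp => by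
          rw [label_old h hv he (hp.trans (hb b h'))]]
        exact h.live b h'
      · rw [hL, Nat.mul_succ]
        have := h.live m le_rfl
        omega
    discarded := fun a ha ha' => by
      have h₁ := he.classCount_eq (a := a) (by omega)
      rw [he.admissible.card a ha ha'] at h₁
      have h₂ := h.discarded a ha ha'
      rw [← h₁, mul_add, mul_one] at h₂
      rw [hL]
      omega
    unused := by
      have h₁ := he.classCount_eq (a := 0) (by omega)
      have h₂ := h.unused
      have h₀ := he.admissible.card_zero h.one_le
      omega
    cnt_le := by
      have h₁ := he.classCount_eq (a := i) hir
      rw [filter_eq_empty_iff.2, card_empty, add_zero] at h₁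
      · rw [h₁]
        exact h.cnt_le
      · intro p hp
        rw [mem_Ico] at hp
        exact (he.admissible.lt p hp.1 hp.2).ne
    edges := fun a ha ha' e hT => by
      refine h.edges a ha ha' e (hT.mono fun x _ hx => ?_)
      by_cases hxy : ∃ q, 1 ≤ q ∧ q < k ∧ (x : ℕ) = y q
      · obtain ⟨q, hq, hq', hxq⟩ := hxy
        rw [hxq, he.label_new q hq hq'] at hx ⊢
        simp only [labelClass] at hx ⊢
        split_ifs at hx ⊢ <;> omega
      · push Not at hxy
        rw [he.label_old _ hxy] }

theorem extend_potential (hk : i < k) (h : SearchInv χ ℓ d i m cnt f lab)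
    (hv : lab (f (m * (k - 1))) = r + 1 + i)
    (he : PathExtension k n r i (m * (k - 1)) f lab y f' lab') :
    searchPotential k n r i (m + 1) f' lab' < searchPotential k n r i m f lab := by
  have h₁ := he.classCount_eq (a := 0) (by omega)
  have h₀ := he.admissible.card_zero h.one_le
  simp only [searchPotential, extend_pathCount (by omega) h hv he, hv, if_true]
  split_ifs <;> omega

end Extend

theorem discard_pathCount_of_lt (h : SearchInv χ ℓ d i m cnt f lab) {N : ℕ}
    (hN : N < m * (k - 1)) (c : ℕ) :
    pathCount N f (Function.update lab (f (m * (k - 1))) i) c = pathCount N f lab c := by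
  refine pathCount_congr fun p hp => ?_
  rw [Function.update_of_ne]
  intro he
  have := h.inj p (by omega) _ le_rfl he
  omega

theorem discard_pathCount (h : SearchInv χ ℓ d i m cnt f lab)
    (hv : lab (f (m * (k - 1))) = r + 1 + i) :
    pathCount (m * (k - 1)) f (Function.update lab (f (m * (k - 1))) i) (r + 1 + i) + 1 =
      pathCount (m * (k - 1)) f lab (r + 1 + i) := by
  simp only [pathCount, card_filter]
  rw [sum_range_succ, sum_range_succ, Function.update_self, if_pos hv, if_neg (by omega), add_zero]
  congr 1
  refine sum_congr rfl fun p hp => ?_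
  rw [mem_range] at hp
  rw [Function.update_of_ne]
  intro he
  have := h.inj p (by omega) _ le_rfl he
  omega

/-- A live vertex becomes a discarded one, so the totals stay the same. New transversal edges arise
only for `a = i` and contain the discarded vertex; their other vertices form an admissible sequence,
so the failed search `hc` excludes the color. -/
theorem discard (hk : 2 ≤ k) (h : SearchInv χ ℓ d i m cnt f lab)
    (hv : lab (f (m * (k - 1))) = r + 1 + i)
    (hc : ∀ y, Combo k n y → y 0 = f (m * (k - 1)) → Admissible k i lab y →
      queriedColor χ y + 1 ≠ i) :
    SearchInv χ ℓ d i m (cnt + 1) f (Function.update lab (f (m * (k - 1))) i) := by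
  have hi := h.one_le
  have hir := h.le_r
  have hL := discard_pathCount h hv
  have hvn := h.lt _ le_rfl
  have hcc : ∀ a < i, classCount n (Function.update lab (f (m * (k - 1))) i) a =
      classCount n lab a := by
    intro a ha
    have := classCount_update (lab := lab) (a := a) hvn i
    rwa [if_neg (by omega), if_neg (by omega)] at this
  have hl : ∀ b < m, b * (k - 1) < m * (k - 1) := fun b hb =>
    Nat.mul_lt_mul_of_pos_right hb (by omega)
  exact
  { one_le := hi
    le_r := hir
    le_ℓ := h.le_ℓ
    lt := h.lt
    inj := h.inj
    label := fun x => by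
      rw [Function.update_apply]
      split_ifs
      · exact .inl le_rfl
      · exact h.label x
    label_path := fun hm p hp => by
      rw [Function.update_apply]
      split_ifs
      · exact le_rfl
      · exact h.label_path hm p hp
    joint := fun b hb => by
      rw [Function.update_of_ne]
      · exact h.joint b hb
      · intro he
        exact (hl b hb).ne (h.inj _ (hl b hb).le _ le_rfl he)
    color := h.color
    live := fun b hb => by
      have h₁ := h.live b hb
      rcases hb.lt_or_eq with hb | rfl
      · rwa [discard_pathCount_of_lt h (hl b hb)]
      · omega
    discarded := fun a ha ha' => by
      have := h.discarded a ha ha'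
      rw [hcc a ha']
      omega
    unused := by
      have := h.unused
      rw [hcc 0 hi]
      omega
    cnt_le := by
      have h₁ := h.cnt_le
      have := classCount_update (lab := lab) (a := i) hvn i
      rw [if_neg (by omega), if_pos rfl] at this
      omega
    edges := fun a ha ha' e hT => by
      by_cases hve : ∃ x ∈ e.1, (x : ℕ) = f (m * (k - 1))
      · obtain ⟨v, hve, hv'⟩ := hve
        rw [← hv'] at hv hT
        rcases ha'.lt_or_eq with ha' | rfl
        · refine h.edges a ha ha'.le e (hT.mono fun x _ hx => ?_)
          rw [Function.update_apply] at hx ⊢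
          split_ifs at hx ⊢ with hxv
          · rw [hxv, hv]
            simp only [labelClass]
            split_ifs <;> omega
          · rfl
        · obtain ⟨y, hy, hy0, himg, hyc⟩ := exists_combo (by omega) χ e hve
          rw [← hyc]
          refine hc y hy (hy0.trans hv') ?_
          have hone := hT.card a ha le_rfl
          rw [card_eq_one] at hone
          obtain ⟨w, hw⟩ := hone
          -- The discarded vertex is the only one of class `a` in the edge, so all others have
          -- labels below `a`.
          have hvw : v = w := by
            rw [← mem_singleton, ← hw, mem_filter, Function.update_self]
            exact ⟨hve, by simp [labelClass]⟩
          have hcls : ∀ x ∈ e.1.erase v, labelClass r a (lab x) =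
              labelClass r a (Function.update lab v a x) := by
            intro x hx
            rw [Function.update_of_ne]
            exact fun h' => ne_of_mem_erase hx (Fin.ext h')
          have hlt : ∀ x ∈ e.1.erase v, lab x < a ∧ labelClass r a (lab x) = lab x := by
            intro x hx
            have h₁ := hT.le x (mem_of_mem_erase hx)
            have h₂ : labelClass r a (lab x) ≠ a := by
              intro h₃
              rw [hcls x hx] at h₃
              have : x ∈ ({w} : Finset (Fin n)) := by
                rw [← hw, mem_filter]
                exact ⟨mem_of_mem_erase hx, h₃⟩
              rw [mem_singleton, ← hvw] at this
              exact ne_of_mem_erase hx this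
            rw [← hcls x hx] at h₁
            have h₃ := h.label x
            simp only [labelClass] at h₁ h₂ ⊢
            split_ifs at h₁ h₂ ⊢ <;> omega
          refine ⟨fun p hp hp' => ?_, fun b hb hb' => ?_⟩
          · have : y p ∈ (Ico 1 k).image y := mem_image_of_mem _ (mem_Ico.2 ⟨hp, hp'⟩)
            rw [himg, mem_image] at this
            obtain ⟨x, hx, hxy⟩ := this
            rw [← hxy]
            exact (hlt x hx).1
          · rw [card_filter_combo hy fun x => lab x = b, himg, filter_image,
              card_image_of_injective _ Fin.val_injective, ← hT.card b hb hb'.le]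
            congr 1
            ext x
            simp only [mem_filter]
            constructor
            · rintro ⟨hx, hxb⟩
              rw [← hcls x hx, (hlt x hx).2]
              exact ⟨mem_of_mem_erase hx, hxb⟩
            · rintro ⟨hx, hxb⟩
              have hx' : x ∈ e.1.erase v := by
                refine mem_erase.2 ⟨?_, hx⟩
                rintro rfl
                rw [Function.update_self] at hxb
                simp only [labelClass, le_refl, if_true] at hxb
                omega
              rw [← hcls x hx', (hlt x hx').2] at hxb
              exact ⟨hx', hxb⟩
      · push Not at hve
        refine h.edges a ha ha' e (hT.mono fun x hx _ => ?_)
        rw [Function.update_of_ne (hve x hx)] }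

theorem discard_potential (h : SearchInv χ ℓ d i m cnt f lab)
    (hv : lab (f (m * (k - 1))) = r + 1 + i) :
    searchPotential k n r i m f (Function.update lab (f (m * (k - 1))) i) <
      searchPotential k n r i m f lab := by
  have h₁ := discard_pathCount h hv
  have h₂ := classCount_update (lab := lab) (a := 0) (h.lt _ le_rfl) i
  have := h.one_le
  rw [if_neg (by omega), if_neg (by omega)] at h₂
  simp only [searchPotential, hv, if_true]
  split_ifs <;> omega

/-- Since one edge is still missing, there is room for `k - i` further live vertices. This slack
absorbs the rounding in `nextStage` and provides the unused vertices in `exists_extension`. -/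
theorem live_le (h : SearchInv χ ℓ d i m cnt f lab) (hm : m < ℓ) :
    pathCount (m * (k - 1)) f lab (r + 1 + i) + (k - i) ≤ (k - i) * ℓ + 1 := by
  have h₁ := h.live m le_rfl
  have h₂ := Nat.mul_le_mul_left (k - i) (Nat.succ_le_of_lt hm)
  rw [Nat.mul_succ] at h₂
  omega

/-- The recursion for `d` is made for this: starting from `d (i - 1)` vertices, a class still has `d
i` of them after `d i` discards. No label is `i + 1` yet, so no edge is transversal for the new
stage. -/
theorem nextStage (hd : Thresholds k ℓ r n d) (h : SearchInv χ ℓ d i m cnt f lab) (hm : m < ℓ)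
    (hir : i < r) (hcnt : cnt = d i) : SearchInv χ ℓ d (i + 1) 0 0 f lab := by
  have hi := h.one_le
  have hrk := hd.r_lt
  have hL := h.live_le hm
  have hdisc : ∀ a, 1 ≤ a → a ≤ i → d i ≤ classCount n lab a := by
    intro a ha hai
    rcases hai.lt_or_eq with hai | rfl
    · have h₁ := h.discarded a ha hai
      have h₂ := hd.step (i - 1) (by omega) (by omega)
      rw [Nat.sub_add_cancel hi] at h₂
      -- The quotient is rounded down; with `K = k - i`, this strict bound and `live_le` turn a
      -- shortage into `K < 1`.
      have h₃ := Nat.lt_mul_div_succ (d i) (show 0 < k - i by omega)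
      by_contra! hlt
      have h₄ := Nat.mul_le_mul_left (k - i) (Nat.succ_le_of_lt hlt)
      rw [h₂, hcnt] at h₁
      have h₅ : 1 ≤ k - i := by omega
      generalize k - i = K at *
      generalize d i / K = q at *
      simp only [Nat.succ_eq_add_one] at h₄
      nlinarith
    · exact hcnt ▸ h.cnt_le
  exact
  { one_le := by omega
    le_r := hir
    le_ℓ := Nat.zero_le _
    lt := fun p hp => h.lt p (hp.trans (by simp))
    inj := fun p hp q hq _ => by
      rw [zero_mul] at hp hq
      omega
    label := fun x => by
      have := h.label x
      omega
    label_path := fun h => absurd h (lt_irrefl 0)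
    joint := fun b hb => absurd hb (Nat.not_lt_zero b)
    color := fun b hb => absurd hb (Nat.not_lt_zero b)
    live := fun b hb => by
      obtain rfl : b = 0 := by omega
      rw [zero_mul]
      exact (pathCount_zero_le _ _ _).trans (by omega)
    discarded := fun a ha ha' => by
      have := Nat.mul_le_mul_left (k - (i + 1)) (hdisc a ha (by omega))
      rw [Nat.add_sub_cancel]
      omega
    unused := by
      have h₁ := h.unused
      rw [sum_Ico_succ_top hi, Nat.add_sub_cancel]
      obtain ⟨j, rfl⟩ : ∃ j, i = j + 1 := ⟨i - 1, by omega⟩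
      rw [Nat.add_sub_cancel] at h₁
      have h₂ : (k - (j + 1)) * ℓ ≤ k * ℓ := Nat.mul_le_mul_right _ (Nat.sub_le _ _)
      have h₃ : (j + 1) * (k * ℓ) = j * (k * ℓ) + k * ℓ := add_one_mul _ _
      omega
    cnt_le := Nat.zero_le _
    edges := fun a ha ha' e he => by
      rcases Nat.le_succ_iff.1 ha' with ha'' | rfl
      · exact h.edges a ha ha'' e he
      · have h₁ := he.card (i + 1) ha le_rfl
        rw [filter_eq_empty_iff.2] at h₁
        · simp at h₁
        · intro x _ hx
          have := h.label x
          simp only [labelClass] at hx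
          split_ifs at hx <;> omega }

theorem nextStage_potential (h : SearchInv χ ℓ d i m cnt f lab)
    (hv : lab (f (m * (k - 1))) = r + 1 + i) :
    searchPotential k n r (i + 1) 0 f (Function.update lab (f (m * (k - 1))) i) <
      searchPotential k n r i m f lab := by
  have h₁ := discard_pathCount h hv
  have h₂ := classCount_update (lab := lab) (a := 0) (h.lt _ le_rfl) i
  have h₃ : pathCount (0 * (k - 1)) f (Function.update lab (f (m * (k - 1))) i)
      (r + 1 + (i + 1)) = 0 := by
    rw [pathCount, card_eq_zero, filter_eq_empty_iff]
    intro p _ hp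
    have := h.label (f p)
    have := h.le_r
    rw [Function.update_apply] at hp
    split_ifs at hp <;> omega
  have := h.one_le
  rw [if_neg (by omega), if_neg (by omega)] at h₂
  simp only [searchPotential, h₃, hv, if_true]
  split_ifs <;> omega

/-- The end vertex, one vertex of each class `1, …, r - 1` and `k - r` unused ones form an edge that
is transversal for every `a < r`: vertices of later classes, unused ones and those live in stage `r`
all have class `0` for stage `a`. Only the color `r - 1` remains. -/
theorem exists_extension (hd : Thresholds k ℓ r n d) (h : SearchInv χ ℓ d r m 0 f lab)
    (hm : m < ℓ) (hv : lab (f (m * (k - 1))) = r + 1 + r) :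
    ∃ y, Combo k n y ∧ y 0 = f (m * (k - 1)) ∧ Admissible k r lab y ∧
      queriedColor χ y + 1 = r := by
  have hr := hd.one_le_r
  have hrk := hd.r_lt
  have hL := h.live_le hm
  let C : ℕ → Finset (Fin n) := fun a => univ.filter fun x => lab x = a
  have hC : ∀ a, #(C a) = classCount n lab a := by
    intro a
    rw [classCount, ← card_image_of_injective _ Fin.val_injective]
    congr 1
    ext x
    simp only [C, mem_image, mem_filter, mem_univ, true_and, mem_range]
    exact ⟨by rintro ⟨y, hy, rfl⟩; exact ⟨y.2, hy⟩, fun hx => ⟨⟨x, hx.1⟩, hx.2, rfl⟩⟩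
  have h₀ : k - r ≤ #(C 0) := by
    rw [hC]
    have h₁ := h.unused
    have h₂ := hd.sum_le
    rw [sum_Ico_succ_top hr, hd.last] at h₂
    have h₃ : (k - r) * ℓ ≤ k * ℓ := Nat.mul_le_mul_right _ (Nat.sub_le _ _)
    obtain ⟨j, hj⟩ : ∃ j, r = j + 1 := ⟨r - 1, by omega⟩
    have h₄ : r * (k * ℓ) = (r - 1) * (k * ℓ) + k * ℓ := by
      rw [hj, Nat.add_sub_cancel, add_one_mul]
    omega
  have hone : ∀ a, 1 ≤ a → a < r → ∃ x, x ∈ C a := by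
    intro a ha har
    have h₁ : 0 < #(C a) := by
      rw [hC]
      by_contra! h₁
      obtain h₁ : classCount n lab a = 0 := by omega
      have h₂ := h.discarded a ha har
      have h₃ := hd.step (r - 1) (by omega) (by omega)
      rw [Nat.sub_add_cancel hr, hd.last] at h₃
      have h₄ : (k - r) * (ℓ + 1) ≤ (k - r) * d (r - 1) := Nat.mul_le_mul_left _ (by
        rw [h₃, add_right_comm, add_comm ℓ]
        exact Nat.le_add_right _ _)
      rw [mul_add, mul_one] at h₄
      rw [h₁, mul_zero] at h₂
      omega
    exact card_pos.1 h₁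
  have : Nonempty (Fin n) := ⟨⟨_, h.lt _ le_rfl⟩⟩
  choose! x hx using hone
  obtain ⟨T, hT, hTc⟩ := exists_subset_card_eq h₀
  have hxl : ∀ a, 1 ≤ a → a < r → lab (x a) = a := fun a ha har => (mem_filter.1 (hx a ha har)).2
  have hTl : ∀ z ∈ T, lab z = 0 := fun z hz => (mem_filter.1 (hT hz)).2
  set X : Finset (Fin n) := (Ico 1 r).image x ∪ T with hX
  have hXl : ∀ z ∈ X, lab z < r := by
    intro z hz
    rcases mem_union.1 hz with hz | hz
    · obtain ⟨a, ha, rfl⟩ := mem_image.1 hz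
      rw [mem_Ico] at ha
      rw [hxl a ha.1 ha.2]
      exact ha.2
    · rw [hTl z hz]
      omega
  have hXc : #X = k - 1 := by
    rw [hX, card_union_of_disjoint, card_image_of_injOn, hTc]
    · simp
      omega
    · intro a ha b hb hab
      rw [mem_coe, mem_Ico] at ha hb
      rw [← hxl a ha.1 ha.2, ← hxl b hb.1 hb.2, hab]
    · rw [disjoint_left]
      intro z hz hz'
      obtain ⟨a, ha, rfl⟩ := mem_image.1 hz
      rw [mem_Ico] at ha
      have h₁ := hxl a ha.1 ha.2
      rw [hTl _ hz'] at h₁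
      omega
  have hXb : ∀ b, 1 ≤ b → b < r → {z ∈ X | lab (z : Fin n) = b} = {x b} := by
    intro b hb hbr
    ext z
    rw [mem_filter, mem_singleton]
    constructor
    · rintro ⟨hz, hzb⟩
      rcases mem_union.1 hz with hz | hz
      · obtain ⟨a, ha, rfl⟩ := mem_image.1 hz
        rw [mem_Ico] at ha
        rw [← hzb, hxl a ha.1 ha.2]
      · rw [hTl z hz] at hzb
        omega
    · rintro rfl
      exact ⟨mem_union_left _ (mem_image_of_mem _ (mem_Ico.2 ⟨hb, hbr⟩)), hxl b hb hbr⟩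
  set v : Fin n := ⟨f (m * (k - 1)), h.lt _ le_rfl⟩ with hvdef
  have hvX : v ∉ X := by
    intro hvX
    have := hXl v hvX
    rw [show lab v = r + 1 + r from hv] at this
    omega
  let e : CompleteEdge n k := ⟨insert v X, by rw [card_insert_of_notMem hvX, hXc]; omega⟩
  obtain ⟨y, hy, hy0, himg, hyc⟩ := exists_combo (by omega) χ e (mem_insert_self v X)
  have herase : e.1.erase v = X := erase_insert hvX
  rw [herase] at himg
  refine ⟨y, hy, hy0, ⟨fun p hp hp' => ?_, fun b hb hb' => ?_⟩, ?_⟩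
  · have : y p ∈ (Ico 1 k).image y := mem_image_of_mem _ (mem_Ico.2 ⟨hp, hp'⟩)
    rw [himg, mem_image] at this
    obtain ⟨z, hz, hzy⟩ := this
    rw [← hzy]
    exact hXl z hz
  · rw [card_filter_combo hy fun x => lab x = b, himg, filter_image,
      card_image_of_injective _ Fin.val_injective, hXb b hb hb', card_singleton]
  · rw [hyc]
    by_contra hne
    have hlt : (χ e : ℕ) + 1 < r := by
      have := (χ e).2
      omega
    -- Here `a = χ e + 1` is the stage of the color that the edge is supposed to have.
    refine h.edges _ (Nat.succ_pos _) hlt.le e ⟨fun z hz => ?_, fun b hb hb' => ?_⟩ rfl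
    · rcases mem_insert.1 hz with rfl | hz
      · rw [show lab v = r + 1 + r from hv]
        simp only [labelClass]
        split_ifs <;> omega
      · have := hXl z hz
        simp only [labelClass]
        split_ifs <;> omega
    · rw [← card_singleton (x b), ← hXb b hb (by omega)]
      congr 1
      ext z
      simp only [e, mem_filter, mem_insert]
      constructor
      · rintro ⟨rfl | hz, hzb⟩
        · rw [show lab v = r + 1 + r from hv] at hzb
          simp only [labelClass] at hzb
          split_ifs at hzb <;> omega
        · have := hXl z hz
          refine ⟨hz, ?_⟩
          simp only [labelClass] at hzb
          split_ifs at hzb <;> omega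
      · rintro ⟨hz, hzb⟩
        refine ⟨.inr hz, ?_⟩
        rw [hzb]
        exact if_pos hb'

theorem exists_copy (hk : 1 ≤ k) (h : SearchInv χ ℓ d i ℓ cnt f lab) :
    ∃ φ : Fin ((k - 1) * ℓ + 1) ↪ Fin n,
      (∀ j : Fin ((k - 1) * ℓ + 1), f (j : ℕ) = (φ j : ℕ)) ∧
        IsMonochromaticCopy (loosePath k ℓ) χ φ := by
  have hle : ∀ j : Fin ((k - 1) * ℓ + 1), (j : ℕ) ≤ ℓ * (k - 1) := fun j =>
    (Nat.lt_succ_iff.1 j.2).trans_eq (mul_comm _ _)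
  let φ : Fin ((k - 1) * ℓ + 1) ↪ Fin n :=
    ⟨fun j => ⟨f j, h.lt j (hle j)⟩, fun a b hab =>
      Fin.ext (h.inj a (hle a) b (hle b) (Fin.mk.inj_iff.1 hab))⟩
  have hi := h.one_le
  have hir := h.le_r
  refine ⟨φ, fun _ => rfl, ⟨i - 1, by omega⟩, fun e he => ?_⟩
  obtain ⟨b, _, rfl⟩ := mem_image.1 he
  have hc := h.color b b.2
  have hb : ((b : ℕ) + 1) * (k - 1) ≤ ℓ * (k - 1) := Nat.mul_le_mul_right _ b.2
  rw [add_one_mul] at hb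
  have hmap : (loosePathEdge k ℓ b).map φ =
      listedVertices n k fun q => f (b * (k - 1) + q) := by
    ext v
    simp only [loosePathEdge, listedVertices, mem_map, mem_filter, mem_univ, true_and, add_one_mul]
    constructor
    · rintro ⟨j, ⟨hj, hj'⟩, rfl⟩
      refine ⟨j - b * (k - 1), by omega, ?_⟩
      rw [Nat.add_sub_cancel' hj]
      rfl
    · rintro ⟨q, hq, hqv⟩
      refine ⟨⟨b * (k - 1) + q, by rw [mul_comm (k - 1)]; omega⟩, ⟨by simp, by simp; omega⟩,
        Fin.ext hqv⟩
  simp only [queriedColor, ← hmap] at hc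
  -- An invalid query would return `r`, but the recorded color is `i - 1 < r`; so the block is an
  -- edge.
  split_ifs at hc with hcard
  · exact ⟨hcard, Fin.ext (by simp only; omega)⟩
  · omega

end SearchInv

/-! ### The depth-first search -/

namespace RamProgram

open RamExpr

/-- The label of the vertices that are put on the path in the current stage. -/
def liveLabel : RamExpr := plus (plus (reg 2) (lit 1)) (reg 6)

/-- Appends the vertices found by the search to the path. -/
def extendPath : RamProgram :=
  assign 8 (lit 1) ⨟
  loop (minus (reg 0) (reg 8))
    (assign 15 (get 1 (reg 8)) ⨟ store 0 (plus (reg 5) (reg 8)) (reg 15) ⨟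
    ite (get 2 (reg 15)) (store 2 (reg 15) (plus (reg 2) (lit 1))) (store 2 (reg 15) liveLabel) ⨟
    assign 8 (plus (reg 8) (lit 1))) ⨟
  assign 4 (plus (reg 4) (lit 1)) ⨟ assign 5 (plus (reg 5) (minus (reg 0) (lit 1)))

/-- Discards the last vertex of the path and begins the next stage if the threshold is reached. -/
def discardLast : RamProgram :=
  store 2 (get 0 (reg 5)) (reg 6) ⨟ assign 7 (plus (reg 7) (lit 1)) ⨟
  ite (minus (get 4 (reg 6)) (reg 7)) skip
    (assign 6 (plus (reg 6) (lit 1)) ⨟ assign 7 (lit 0) ⨟ assign 4 (lit 0) ⨟ assign 5 (lit 0))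

/-- Starts a new path in an unused vertex. -/
def findRoot : RamProgram :=
  assign 15 (lit 0) ⨟ loop (get 2 (reg 15)) (assign 15 (plus (reg 15) (lit 1))) ⨟
  store 0 (lit 0) (reg 15) ⨟ store 2 (reg 15) liveLabel

/-- Moves a live vertex of the last edge to the end of the path, or removes the last edge if there
is no such vertex. -/
def backtrack : RamProgram :=
  assign 15 (reg 5) ⨟
  loop (ne (get 2 (get 0 (reg 15))) liveLabel) (assign 15 (minus (reg 15) (lit 1))) ⨟
  -- Tests whether the scan stopped strictly after the first vertex of the last edge, a joint, which
  -- is live and so stops the scan at the latest.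
  ite (minus (plus (reg 15) (minus (reg 0) (lit 1))) (reg 5))
    (assign 16 (get 0 (reg 15)) ⨟ store 0 (reg 15) (get 0 (reg 5)) ⨟ store 0 (reg 5) (reg 16))
    (assign 4 (minus (reg 4) (lit 1)) ⨟ assign 5 (minus (reg 5) (minus (reg 0) (lit 1))))

/-- One round of the depth-first search. -/
def searchStep : RamProgram :=
  ite (ne (get 2 (get 0 (reg 5))) liveLabel) (ite (reg 4) backtrack findRoot)
    (search ⨟ ite (reg 9) extendPath discardLast)

/-- The depth-first search. -/
def depthFirstSearch : RamProgram := loop (minus (reg 1) (reg 4)) searchStep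

end RamProgram

/-! ### Correctness and cost of the depth-first search -/

namespace Runs

open RamProgram RamExpr

variable {n k r : ℕ} {χ : EdgeColoring n k r} {s : RamState}

theorem extendPath (hk : 1 ≤ s.reg 0) (hc : Combo (s.reg 0) (s.reg 3) (s.arr 1))
    (ha : Admissible (s.reg 0) (s.reg 6) (s.arr 2) (s.arr 1))
    (h0 : s.arr 1 0 = s.arr 0 (s.reg 5)) :
    Runs χ extendPath s (60 * s.reg 0) fun s' => s'.reg 4 = s.reg 4 + 1 ∧
      s'.reg 5 = s.reg 5 + (s.reg 0 - 1) ∧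
      PathExtension (s.reg 0) (s.reg 3) (s.reg 2) (s.reg 6) (s.reg 5) (s.arr 0) (s.arr 2) (s.arr 1)
        (s'.arr 0) (s'.arr 2) := by
  refine le_time (seq_assign (seq_of (loop
    (fun s' => 1 ≤ s'.reg 8 ∧ s'.reg 8 ≤ s.reg 0 ∧
      (∀ p ≤ s.reg 5, s'.arr 0 p = s.arr 0 p) ∧
      (∀ q, 1 ≤ q → q < s'.reg 8 → s'.arr 0 (s.reg 5 + q) = s.arr 1 q) ∧
      (∀ q, 1 ≤ q → q < s'.reg 8 → s'.arr 2 (s.arr 1 q) =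
        if s.arr 2 (s.arr 1 q) = 0 then s.reg 2 + 1 + s.reg 6 else s.reg 2 + 1) ∧
      (∀ x, (∀ q, 1 ≤ q → q < s'.reg 8 → x ≠ s.arr 1 q) → s'.arr 2 x = s.arr 2 x))
    (fun s' => s.reg 0 - s'.reg 8) 35 ?_ ?_) (T' := 12) ?_)) ?_
  · simp only [eval, RamState.setReg_reg, if_true, RamState.setReg_arr]
    exact ⟨le_rfl, hk, fun _ _ => trivial, fun q hq hq' => by omega, fun q hq hq' => by omega,
      fun _ _ => trivial⟩
  · rintro s' ha ⟨h₁, h₂, h₃, h₄, h₅, h₆⟩ hb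
    have e0 : s'.reg 0 = s.reg 0 := by simpa using ha.reg 0 (by decide)
    have e2 : s'.reg 2 = s.reg 2 := by simpa using ha.reg 2 (by decide)
    have e5 : s'.reg 5 = s.reg 5 := by simpa using ha.reg 5 (by decide)
    have e6 : s'.reg 6 = s.reg 6 := by simpa using ha.reg 6 (by decide)
    have e1 : s'.arr 1 = s.arr 1 := by simpa using ha.arr 1 (by decide)
    simp only [eval, e0] at hb
    have hinj : ∀ q, 1 ≤ q → q < s'.reg 8 → s.arr 1 q < s.arr 1 (s'.reg 8) := fun q hq hq' =>
      hc.strictMono hq hq' h₂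
    -- The entries are distinct, so the label read now is still the one from before the extension.
    have hold := h₆ (s.arr 1 (s'.reg 8)) fun q hq hq' => (hinj q hq hq').ne'
    have key : ∀ g l : ℕ → ℕ,
        g = Function.update (s'.arr 0) (s.reg 5 + s'.reg 8) (s.arr 1 (s'.reg 8)) →
        l = Function.update (s'.arr 2) (s.arr 1 (s'.reg 8))
          (if s.arr 2 (s.arr 1 (s'.reg 8)) = 0 then s.reg 2 + 1 + s.reg 6 else s.reg 2 + 1) →
        (∀ p ≤ s.reg 5, g p = s.arr 0 p) ∧
        (∀ q, 1 ≤ q → q < s'.reg 8 + 1 → g (s.reg 5 + q) = s.arr 1 q) ∧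
        (∀ q, 1 ≤ q → q < s'.reg 8 + 1 → l (s.arr 1 q) =
          if s.arr 2 (s.arr 1 q) = 0 then s.reg 2 + 1 + s.reg 6 else s.reg 2 + 1) ∧
        (∀ x, (∀ q, 1 ≤ q → q < s'.reg 8 + 1 → x ≠ s.arr 1 q) → l x = s.arr 2 x) := by
      rintro g l rfl rfl
      refine ⟨fun p hp => ?_, fun q hq hq' => ?_, fun q hq hq' => ?_, fun x hx => ?_⟩
      · rw [Function.update_of_ne (by omega), h₃ p hp]
      · rcases Nat.lt_succ_iff_lt_or_eq.1 hq' with h | rfl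
        · rw [Function.update_of_ne (by omega), h₄ q hq h]
        · rw [Function.update_self]
      · rcases Nat.lt_succ_iff_lt_or_eq.1 hq' with h | rfl
        · rw [Function.update_of_ne (hinj q hq h).ne, h₅ q hq h]
        · rw [Function.update_self]
      · rw [Function.update_of_ne (hx _ h₁ (by omega)), h₆ x fun q hq hq' => hx q hq (by omega)]
    refine le_time (T := 35) ?_ le_rfl
    refine le_time (seq_assign (seq_store (seq (T := 20) (T' := 5) ?_))) (by simp [cost])
    refine le_time (ite (T := 10) (fun hc => le_time (store ?_) (by simp [cost])) fun hc =>
      le_time (store ?_) (by simp [cost, liveLabel])) (by simp [cost])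
    all_goals
      refine le_time (assign ?_) (by simp [cost])
      simp only [eval, RamState.setReg_reg, RamState.setReg_arr, RamState.setArr_arr,
        RamState.setArr_reg, if_true, Nat.reduceEqDiff, if_false, liveLabel, e1, e2, e5, e6,
        reduceCtorEq, OfNat.ofNat_ne_zero] at hc ⊢
      rw [hold] at hc
      refine ⟨⟨by omega, by omega, key _ _ rfl (by simp [hc])⟩, by omega⟩
  · rintro s₁ ha₁ ⟨⟨h₁, h₂, h₃, h₄, h₅, h₆⟩, hb⟩
    have e0 : s₁.reg 0 = s.reg 0 := by simpa using ha₁.reg 0 (by decide)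
    have e4 : s₁.reg 4 = s.reg 4 := by simpa using ha₁.reg 4 (by decide)
    have e5 : s₁.reg 5 = s.reg 5 := by simpa using ha₁.reg 5 (by decide)
    simp only [eval, e0] at hb
    have h8 : s₁.reg 8 = s.reg 0 := by omega
    rw [h8] at h₄ h₅ h₆
    refine le_time (seq_assign (assign ?_)) (by simp [cost])
    simp only [eval, RamState.setReg_reg, RamState.setReg_arr, e0, e4, e5]
    exact ⟨by simp, by simp, hc, ha, h0, h₃, h₄, h₅, h₆⟩
  · simp [cost, eval]
    omega

theorem findRoot {x₀ : ℕ} (hx₀ : s.arr 2 x₀ = 0) :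
    Runs χ findRoot s (20 * x₀ + 30) fun s' => ∃ x ≤ x₀, s.arr 2 x = 0 ∧
      s'.arr 0 = Function.update (s.arr 0) 0 x ∧
      s'.arr 2 = Function.update (s.arr 2) x (s.reg 2 + 1 + s.reg 6) := by
  refine le_time (seq_assign (seq_of (loop (fun s' => s'.reg 15 ≤ x₀) (fun s' => x₀ - s'.reg 15) 4
    ?_ ?_) (T' := 14) ?_)) ?_
  · simp [eval]
  · rintro s' ha h₁ hb
    have e2 : s'.arr 2 = s.arr 2 := by simpa using ha.arr 2 (by decide)
    simp only [eval, e2] at hb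
    have : s'.reg 15 ≠ x₀ := by
      rintro rfl
      exact hb hx₀
    refine le_time (assign ?_) (by simp [cost])
    simp [eval]
    omega
  · rintro s₁ ha₁ ⟨h₁, hb⟩
    have e2 : s₁.reg 2 = s.reg 2 := by simpa using ha₁.reg 2 (by decide)
    have e6 : s₁.reg 6 = s.reg 6 := by simpa using ha₁.reg 6 (by decide)
    have f0 : s₁.arr 0 = s.arr 0 := by simpa using ha₁.arr 0 (by decide)
    have f2 : s₁.arr 2 = s.arr 2 := by simpa using ha₁.arr 2 (by decide)
    simp only [eval, f2] at hb
    refine le_time (seq_store (store ?_)) (by simp [cost, liveLabel])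
    exact ⟨s₁.reg 15, h₁, hb, by simp [eval, f0], by simp [eval, f2, e2, e6, liveLabel]⟩
  · simp [cost, eval]
    omega

theorem backtrack {N : ℕ} (hk : 2 ≤ s.reg 0) (hN : s.reg 5 = N + (s.reg 0 - 1))
    (h0 : s.arr 2 (s.arr 0 N) = s.reg 2 + 1 + s.reg 6)
    (h1 : s.arr 2 (s.arr 0 (s.reg 5)) ≠ s.reg 2 + 1 + s.reg 6) :
    Runs χ backtrack s (60 * s.reg 0) fun s' =>
      (s'.reg 4 = s.reg 4 ∧ s'.reg 5 = s.reg 5 ∧ ∃ q, N < q ∧ q ≤ s.reg 5 ∧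
        s.arr 2 (s.arr 0 q) = s.reg 2 + 1 + s.reg 6 ∧
        s'.arr 0 = fun p => s.arr 0 (Equiv.swap q (s.reg 5) p)) ∨
      (s'.reg 4 = s.reg 4 - 1 ∧ s'.reg 5 = N ∧ s'.arr 0 = s.arr 0 ∧
        ∀ p, N < p → p ≤ s.reg 5 → s.arr 2 (s.arr 0 p) ≠ s.reg 2 + 1 + s.reg 6) := by
  refine le_time (seq_assign (seq_of (loop (fun s' => N ≤ s'.reg 15 ∧ s'.reg 15 ≤ s.reg 5 ∧
      ∀ p, s'.reg 15 < p → p ≤ s.reg 5 → s.arr 2 (s.arr 0 p) ≠ s.reg 2 + 1 + s.reg 6)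
    (fun s' => s'.reg 15 - N) 4 ?_ ?_) (T' := 40) ?_)) ?_
  · simp [eval, hN]
    omega
  · rintro s' ha ⟨h₁, h₂, h₃⟩ hb
    have e2 : s'.reg 2 = s.reg 2 := by simpa using ha.reg 2 (by decide)
    have e6 : s'.reg 6 = s.reg 6 := by simpa using ha.reg 6 (by decide)
    have f0 : s'.arr 0 = s.arr 0 := by simpa using ha.arr 0 (by decide)
    have f2 : s'.arr 2 = s.arr 2 := by simpa using ha.arr 2 (by decide)
    rw [Ne, eval_ne] at hb
    simp only [eval, liveLabel, f0, f2, e2, e6] at hb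
    have hne : s'.reg 15 ≠ N := by
      intro he
      rw [he] at hb
      exact hb h0
    refine le_time (assign ?_) (by simp [cost])
    simp only [eval, RamState.setReg_reg, if_true]
    refine ⟨⟨by omega, by omega, fun p hp hp' => ?_⟩, by omega⟩
    rcases eq_or_ne p (s'.reg 15) with rfl | hpe
    · exact hb
    · exact h₃ p (by omega) hp'
  · rintro s₁ ha₁ ⟨⟨h₁, h₂, h₃⟩, hb⟩
    have e0 : s₁.reg 0 = s.reg 0 := by simpa using ha₁.reg 0 (by decide)
    have e2 : s₁.reg 2 = s.reg 2 := by simpa using ha₁.reg 2 (by decide)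
    have e4 : s₁.reg 4 = s.reg 4 := by simpa using ha₁.reg 4 (by decide)
    have e5 : s₁.reg 5 = s.reg 5 := by simpa using ha₁.reg 5 (by decide)
    have e6 : s₁.reg 6 = s.reg 6 := by simpa using ha₁.reg 6 (by decide)
    have f0 : s₁.arr 0 = s.arr 0 := by simpa using ha₁.arr 0 (by decide)
    have f2 : s₁.arr 2 = s.arr 2 := by simpa using ha₁.arr 2 (by decide)
    rw [eval_ne] at hb
    simp only [eval, liveLabel, f0, f2, e2, e6] at hb
    refine le_time (ite (T := 20) (fun hc => le_time (seq_assign (seq_store (store ?_)))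
      (by simp [cost])) fun hc => le_time (seq_assign (assign ?_)) (by simp [cost]))
      (by simp [cost])
    · simp only [eval, e0, e5] at hc
      refine .inl ⟨by simp [e4], by simp [e5], s₁.reg 15, by omega, h₂, hb, ?_⟩
      have hne : s₁.reg 15 ≠ s.reg 5 := by
        intro he
        rw [he] at hb
        exact h1 hb
      simp only [eval, RamState.setReg_reg, RamState.setReg_arr, RamState.setArr_arr,
        RamState.setArr_reg, if_true, Nat.reduceEqDiff, if_false, f0, e5]
      funext p
      rw [Function.update_apply, Function.update_apply, Equiv.swap_apply_def]
      split_ifs with h₄ h₅ h₆ <;> simp_all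
    · simp only [eval, e0, e5] at hc
      refine .inr ⟨by simp [eval, e4], by simp [eval, e5, e0]; omega, f0, fun p hp hp' => ?_⟩
      exact h₃ p (by omega) hp'
  · simp [cost, eval, liveLabel, hN]
    omega

theorem searchStep {ℓ m cnt i : ℕ} {d : ℕ → ℕ} (hd : Thresholds k ℓ r n d) (hk : 2 ≤ k)
    (h : SearchInv χ ℓ d i m cnt (s.arr 0) (s.arr 2)) (hm : m < ℓ) (hcnt : cnt < d i)
    (h0 : s.reg 0 = k) (h2 : s.reg 2 = r) (h3 : s.reg 3 = n) (h4 : s.reg 4 = m)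
    (h5 : s.reg 5 = m * (k - 1)) (h6 : s.reg 6 = i) (h7 : s.reg 7 = cnt) (hd4 : s.arr 4 = d) :
    Runs χ searchStep s (500 * (k * (k + 1) * n.choose (k - 1)) + 20 * n + 60) fun s' =>
      SearchInv χ ℓ d (s'.reg 6) (s'.reg 4) (s'.reg 7) (s'.arr 0) (s'.arr 2) ∧
      s'.reg 5 = s'.reg 4 * (k - 1) ∧ s'.reg 7 < d (s'.reg 6) ∧
      searchPotential k n r (s'.reg 6) (s'.reg 4) (s'.arr 0) (s'.arr 2) <
        searchPotential k n r i m (s.arr 0) (s.arr 2) := by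
  have hkn : k ≤ n + 1 := by
    have h₁ := hd.sum_le
    have h₂ : 1 * (k * 1) ≤ r * (k * ℓ) :=
      Nat.mul_le_mul hd.one_le_r (Nat.mul_le_mul_left _ hd.one_le_ℓ)
    omega
  have hC : 1 ≤ n.choose (k - 1) := Nat.choose_pos (by omega)
  have hKC : k * 2 * 1 ≤ k * (k + 1) * n.choose (k - 1) :=
    Nat.mul_le_mul (Nat.mul_le_mul_left _ (by omega)) hC
  have hi := h.one_le
  have hir := h.le_r
  have hrk := hd.r_lt
  set B := k * (k + 1) * n.choose (k - 1) with hB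
  refine le_time (ite (T := 500 * B + 20 * n + 40) (fun hv => ?_) fun hv => ?_)
    (by simp [cost, liveLabel]; omega)
  · rw [Ne, eval_ne] at hv
    simp only [eval, liveLabel, h2, h5, h6] at hv
    refine le_time (ite (T := 60 * k + 20 * n + 30) (fun hb => ?_) fun hb => ?_)
      (by simp [cost]; omega)
    · simp only [eval, h4] at hb
      obtain ⟨m, rfl⟩ : ∃ m', m = m' + 1 := ⟨m - 1, by omega⟩
      refine (backtrack (s := s) (N := m * (k - 1)) (by omega) (by rw [h5, h0, add_one_mul])
        (by rw [h2, h6]; exact h.joint m (by omega)) (by rw [h2, h5, h6]; exact hv)).conseq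
        (by rw [h0]; omega) ?_
      rintro s' ha (⟨e4, e5, q, hq, hq', hql, e0⟩ | ⟨e4, e5, e0, hq⟩)
      · have e6 : s'.reg 6 = s.reg 6 := ha.reg 6 (by decide)
        have e7 : s'.reg 7 = s.reg 7 := ha.reg 7 (by decide)
        have f2 : s'.arr 2 = s.arr 2 := ha.arr 2 (by decide)
        rw [h5] at hq' e0 e5
        rw [h2, h6] at hql
        rw [e6, e7, e4, e0, f2, h4, h6, h7, e5]
        exact ⟨h.swap hq hq', rfl, hcnt, SearchInv.swap_potential hv hq' hql⟩
      · have e6 : s'.reg 6 = s.reg 6 := ha.reg 6 (by decide)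
        have e7 : s'.reg 7 = s.reg 7 := ha.reg 7 (by decide)
        have f2 : s'.arr 2 = s.arr 2 := ha.arr 2 (by decide)
        rw [h2, h5, h6] at hq
        rw [e6, e7, e4, e0, f2, h4, h6, h7, e5]
        exact ⟨h.pop hq, rfl, hcnt, h.pop_potential⟩
    · simp only [eval, h4] at hb
      subst hb
      rw [zero_mul] at hv
      obtain ⟨x₀, hx₀, hx₀'⟩ := h.exists_unused hd hv hcnt
      refine (findRoot hx₀').conseq (by omega) ?_
      rintro s' ha ⟨x, hx, hx', e0, e2⟩
      have e6 : s'.reg 6 = s.reg 6 := ha.reg 6 (by decide)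
      have e7 : s'.reg 7 = s.reg 7 := ha.reg 7 (by decide)
      have e4 : s'.reg 4 = s.reg 4 := ha.reg 4 (by decide)
      have e5 : s'.reg 5 = s.reg 5 := ha.reg 5 (by decide)
      rw [e6, e7, e4, e0, e2, h2, h4, h6, h7, e5, h5]
      exact ⟨h.newRoot hv (by omega) hx', rfl, hcnt, SearchInv.newRoot_potential hv (by omega) hx'⟩
  · rw [eval_ne] at hv
    simp only [eval, liveLabel, h2, h5, h6] at hv
    refine le_time (seq_of (T := 400 * B) (T' := 60 * k + 30)
      (le_time (search (by omega) h0 (by omega) (by omega))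
        (by rw [h3, hB]; exact (by ring : _ = _).le)) ?_) (by omega)
    rintro s₁ ha₁ ⟨g₀, g₁⟩
    have e0 : s₁.reg 0 = k := (ha₁.reg 0 (by decide)).trans h0
    have e2 : s₁.reg 2 = r := (ha₁.reg 2 (by decide)).trans h2
    have e3 : s₁.reg 3 = n := (ha₁.reg 3 (by decide)).trans h3
    have e4 : s₁.reg 4 = m := (ha₁.reg 4 (by decide)).trans h4
    have e5 : s₁.reg 5 = m * (k - 1) := (ha₁.reg 5 (by decide)).trans h5
    have e6 : s₁.reg 6 = i := (ha₁.reg 6 (by decide)).trans h6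
    have e7 : s₁.reg 7 = cnt := (ha₁.reg 7 (by decide)).trans h7
    have f0 : s₁.arr 0 = s.arr 0 := ha₁.arr 0 (by decide)
    have f2 : s₁.arr 2 = s.arr 2 := ha₁.arr 2 (by decide)
    have f4 : s₁.arr 4 = d := (ha₁.arr 4 (by decide)).trans hd4
    rw [h5] at g₀
    rw [h0, h3, h5, h6] at g₁
    refine le_time (ite (T := 60 * k + 25) (fun hb => ?_) fun hb => ?_) (by simp [cost]; omega)
    · simp only [eval] at hb
      obtain ⟨-, hy, hadm, hcol⟩ := g₁.resolve_right fun h => hb h.1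
      refine (extendPath (by omega) (by rwa [e0, e3]) (by rwa [e0, e6, f2])
        (by rw [e5, f0, g₀])).conseq (by rw [e0]; omega) ?_
      rintro s' ha ⟨j₄, j₅, hext⟩
      have e6' : s'.reg 6 = s₁.reg 6 := ha.reg 6 (by decide)
      have e7' : s'.reg 7 = s₁.reg 7 := ha.reg 7 (by decide)
      rw [e0, e2, e3, e5, e6, f0, f2] at hext
      rw [e6', e7', j₄, j₅, e0, e4, e5, e6, e7, add_one_mul]
      exact ⟨SearchInv.extend (by omega) h hv hext hm hcol, rfl, hcnt,
        SearchInv.extend_potential (by omega) h hv hext⟩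
    · simp only [eval] at hb
      have hno := (g₁.resolve_left fun h => by omega).2
      have hdis := h.discard hk hv hno
      refine le_time (seq_store (seq_assign (ite (T := 10) (fun hc => le_time (skip ?_)
        (by simp)) fun hc => le_time (seq_assign (seq_assign (seq_assign (assign ?_))))
        (by simp [cost])))) (by simp [cost])
      · simp only [eval, RamState.setReg_reg, RamState.setReg_arr, RamState.setArr_arr,
          RamState.setArr_reg, if_true, Nat.reduceEqDiff, if_false, e4, e5, e6, e7, f0, f2, f4,
          OfNat.zero_ne_ofNat] at hc ⊢
        exact ⟨hdis, trivial, by omega, h.discard_potential hv⟩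
      · simp only [eval, RamState.setReg_reg, RamState.setReg_arr, RamState.setArr_arr,
          RamState.setArr_reg, if_true, Nat.reduceEqDiff, if_false, e4, e5, e6, e7, f0, f2, f4,
          OfNat.zero_ne_ofNat] at hc ⊢
        have hir' : i < r := by
          refine lt_of_le_of_ne hir ?_
          rintro rfl
          -- As `d r = 1`, this would be the first discard of stage `r`, which `exists_extension`
          -- rules out.
          have hl := hd.last
          obtain rfl : cnt = 0 := by omega
          obtain ⟨y, hy, hy0, hya, hyc⟩ := h.exists_extension hd hm hv
          exact hno y hy hy0 hya hyc
        exact ⟨hdis.nextStage hd hm hir' (by omega), by simp, hd.pos (by omega) hir',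
          h.nextStage_potential hv⟩

theorem depthFirstSearch {ℓ : ℕ} {d : ℕ → ℕ} (hd : Thresholds k ℓ r n d) (hk : 2 ≤ k)
    (h : SearchInv χ ℓ d (s.reg 6) (s.reg 4) (s.reg 7) (s.arr 0) (s.arr 2))
    (hcnt : s.reg 7 < d (s.reg 6)) (h0 : s.reg 0 = k) (h1 : s.reg 1 = ℓ) (h2 : s.reg 2 = r)
    (h3 : s.reg 3 = n) (h5 : s.reg 5 = s.reg 4 * (k - 1)) (hd4 : s.arr 4 = d) :
    Runs χ depthFirstSearch s (searchPotential k n r (s.reg 6) (s.reg 4) (s.arr 0) (s.arr 2) *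
        (500 * (k * (k + 1) * n.choose (k - 1)) + 20 * n + 64) + 4) fun s' =>
      ∃ φ : Fin ((k - 1) * ℓ + 1) ↪ Fin n,
        (∀ j : Fin ((k - 1) * ℓ + 1), s'.arr 0 (j : ℕ) = (φ j : ℕ)) ∧
          IsMonochromaticCopy (loosePath k ℓ) χ φ := by
  refine (loop (fun s' => SearchInv χ ℓ d (s'.reg 6) (s'.reg 4) (s'.reg 7) (s'.arr 0) (s'.arr 2) ∧
      s'.reg 5 = s'.reg 4 * (k - 1) ∧ s'.reg 7 < d (s'.reg 6))
    (fun s' => searchPotential k n r (s'.reg 6) (s'.reg 4) (s'.arr 0) (s'.arr 2))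
    (500 * (k * (k + 1) * n.choose (k - 1)) + 20 * n + 60) ⟨h, h5, hcnt⟩ ?_).conseq ?_ ?_
  · rintro s' ha ⟨i₁, i₂, i₃⟩ hb
    have e0 : s'.reg 0 = k := (ha.reg 0 (by decide)).trans h0
    have e1 : s'.reg 1 = ℓ := (ha.reg 1 (by decide)).trans h1
    have e2 : s'.reg 2 = r := (ha.reg 2 (by decide)).trans h2
    have e3 : s'.reg 3 = n := (ha.reg 3 (by decide)).trans h3
    have f4 : s'.arr 4 = d := (ha.arr 4 (by decide)).trans hd4
    simp only [eval, e1] at hb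
    refine (searchStep hd hk i₁ (by omega) i₃ e0 e2 e3 rfl i₂ rfl rfl f4).conseq le_rfl ?_
    rintro s'' - ⟨j₁, j₂, j₃, j₄⟩
    exact ⟨⟨j₁, j₂, j₃⟩, j₄⟩
  · simp only [cost]
    exact add_le_add (Nat.mul_le_mul_left _ (by omega)) (by omega)
  · rintro s' ha ⟨⟨i₁, i₂, i₃⟩, hb⟩
    have e1 : s'.reg 1 = ℓ := (ha.reg 1 (by decide)).trans h1
    simp only [eval, e1] at hb
    have hm : s'.reg 4 = ℓ := by
      have := i₁.le_ℓ
      omega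
    rw [hm] at i₁
    exact i₁.exists_copy (by omega)

end Runs

/-! ### The thresholds -/

/-- The number of vertices to be discarded `j` stages before stage `r`, where `D = k - r`. -/
def threshold (D ℓ : ℕ) : ℕ → ℕ
  | 0 => 1
  | j + 1 => threshold D ℓ j + threshold D ℓ j / (D + j) + ℓ

/-- Divided by `D + j`, the threshold grows by at most `ℓ / (D + j + 1)` per step, and this is at
most `ℓ` times the increment of the logarithm. -/
theorem threshold_le {D : ℕ} (hD : 1 ≤ D) (ℓ j : ℕ) :
    (threshold D ℓ j : ℝ) ≤ ((D : ℝ) + j) * (1 + ℓ * Real.log (((D : ℝ) + j) / D)) := by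
  have hD' : (1 : ℝ) ≤ D := by exact_mod_cast hD
  induction j with
  | zero => simpa [threshold, div_self (show (D : ℝ) ≠ 0 by positivity)] using hD'
  | succ j ih =>
    have hx : (0 : ℝ) < (D : ℝ) + j := by positivity
    have hdiv : ((threshold D ℓ j / (D + j) : ℕ) : ℝ) ≤ threshold D ℓ j / ((D : ℝ) + j) := by
      exact_mod_cast Nat.cast_div_le
    have hlog : 1 ≤ ((D : ℝ) + j + 1) *
        (Real.log (((D : ℝ) + j + 1) / D) - Real.log (((D : ℝ) + j) / D)) := by
      rw [← Real.log_div (by positivity) (by positivity), div_div_div_cancel_right₀ (by positivity)]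
      -- For `x = (D + j + 1) / (D + j)` the left side `1 - 1 / x` is exactly `1 / (D + j + 1)`.
      have h := Real.one_sub_inv_le_log_of_pos
        (show 0 < ((D : ℝ) + j + 1) / ((D : ℝ) + j) by positivity)
      calc (1 : ℝ) = ((D : ℝ) + j + 1) * (1 - (((D : ℝ) + j + 1) / ((D : ℝ) + j))⁻¹) := by
            field_simp
            ring
        _ ≤ _ := by gcongr
    have hstep : (threshold D ℓ j : ℝ) + threshold D ℓ j / ((D : ℝ) + j) ≤
        ((D : ℝ) + j + 1) * (1 + ℓ * Real.log (((D : ℝ) + j) / D)) := by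
      rw [show (threshold D ℓ j : ℝ) + threshold D ℓ j / ((D : ℝ) + j) =
        (threshold D ℓ j / ((D : ℝ) + j)) * ((D : ℝ) + j + 1) by field_simp, mul_comm]
      gcongr
      rwa [div_le_iff₀' hx]
    have hℓ : (0 : ℝ) ≤ ℓ := Nat.cast_nonneg ℓ
    simp only [threshold]
    push_cast
    rw [← add_assoc]
    nlinarith [mul_le_mul_of_nonneg_left hlog hℓ]

/-- With `Λ` the logarithm, the thresholds before the last sum to at most `(r - 1) * (k - 1) * (1 +
ℓ * Λ)`. Adding `1 + r * k * ℓ` gives at most `r * k * (1 + ℓ * Λ + ℓ)`, which falls short of the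
assumed bound by `r * k * Λ`. -/
theorem thresholds_of_le {k ℓ r n : ℕ} (hℓ : 1 ≤ ℓ) (hr : 1 ≤ r) (hrk : r < k)
    (hn : (k : ℝ) * ((ℓ : ℝ) + 1) * (r : ℝ) *
      (1 + Real.log (1 + ((r : ℝ) - 1) / ((k : ℝ) - (r : ℝ)))) ≤ (n : ℝ)) {d : ℕ → ℕ}
    (hd : ∀ a, 1 ≤ a → a ≤ r → d a = threshold (k - r) ℓ (r - a)) : Thresholds k ℓ r n d := by
  obtain ⟨D, rfl⟩ : ∃ D, k = r + D := ⟨k - r, by omega⟩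
  have hD : 1 ≤ D := by omega
  rw [Nat.add_sub_cancel_left] at hd
  refine ⟨hr, hrk, hℓ, ?_, fun a ha har => ?_, ?_⟩
  · rw [hd r hr le_rfl, Nat.sub_self, threshold]
  · rw [hd a ha har.le, hd (a + 1) (by omega) har, show r - a = r - (a + 1) + 1 by omega,
      show r + D - (a + 1) = D + (r - (a + 1)) by omega, threshold]
  · have hD' : (1 : ℝ) ≤ D := by exact_mod_cast hD
    have hr' : (1 : ℝ) ≤ r := by exact_mod_cast hr
    have hℓ' : (1 : ℝ) ≤ ℓ := by exact_mod_cast hℓ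
    set Λ := Real.log (1 + ((r : ℝ) - 1) / D) with hΛ
    have hΛ0 : 0 ≤ Λ := Real.log_nonneg (by
      have : 0 ≤ ((r : ℝ) - 1) / D := div_nonneg (by linarith) (by linarith)
      linarith)
    have hterm : ∀ a ∈ Ico 1 r, (d a : ℝ) ≤ ((D : ℝ) + r - 1) * (1 + ℓ * Λ) := by
      intro a ha
      rw [mem_Ico] at ha
      rw [hd a ha.1 ha.2.le]
      have ha' : ((r - a : ℕ) : ℝ) ≤ (r : ℝ) - 1 := by
        rw [Nat.cast_sub ha.2.le]
        have : (1 : ℝ) ≤ a := by exact_mod_cast ha.1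
        linarith
      have hlog : Real.log (((D : ℝ) + (r - a : ℕ)) / D) ≤ Λ := by
        refine Real.log_le_log (by positivity) ?_
        rw [add_div, div_self (by positivity)]
        gcongr
      have hlog0 : 0 ≤ Real.log (((D : ℝ) + (r - a : ℕ)) / D) := by
        refine Real.log_nonneg ?_
        rw [add_div, div_self (by positivity)]
        have : (0 : ℝ) ≤ ((r - a : ℕ) : ℝ) / D := by positivity
        linarith
      refine (threshold_le hD ℓ (r - a)).trans ?_
      rw [add_sub_assoc]
      gcongr
    have hlast : (d r : ℝ) = 1 := by
      rw [hd r hr le_rfl, Nat.sub_self, threshold, Nat.cast_one]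
    have hsum := sum_le_card_nsmul _ _ _ hterm
    rw [Nat.card_Ico, nsmul_eq_mul, Nat.cast_sub hr, Nat.cast_one] at hsum
    have hcast : ((r + D : ℕ) : ℝ) - r = D := by push_cast; ring
    rw [hcast, ← hΛ] at hn
    rw [sum_Ico_succ_top hr]
    have hgoal : (∑ a ∈ Ico 1 r, (d a : ℝ)) + d r + r * ((r + D) * ℓ) ≤ n := by
      refine le_trans ?_ hn
      rw [hlast]
      push_cast
      have h₁ : ((r : ℝ) - 1) * (((D : ℝ) + r - 1) * (1 + ℓ * Λ)) ≤
          ((r : ℝ) - 1) * (((D : ℝ) + r) * (1 + ℓ * Λ)) := by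
        have : 0 ≤ (ℓ : ℝ) * Λ := by positivity
        gcongr
        · linarith
      have h₂ : ((r : ℝ) - 1) * (((D : ℝ) + r) * (1 + ℓ * Λ)) + 1 ≤
          r * (((D : ℝ) + r) * (1 + ℓ * Λ)) := by
        have h₃ : 0 ≤ (ℓ : ℝ) * Λ := by positivity
        have h₄ : 1 ≤ ((D : ℝ) + r) * (1 + ℓ * Λ) := by nlinarith
        linarith
      have h₅ : 0 ≤ (r : ℝ) * ((D : ℝ) + r) * Λ := by positivity
      nlinarith
    exact_mod_cast hgoal

/-! ### Computing the thresholds; the complete algorithm -/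

namespace RamProgram

open RamExpr

/-- Divides the content of register 16 by that of register 18. -/
def divide : RamProgram :=
  assign 17 (lit 0) ⨟
  loop (minus (plus (reg 16) (lit 1)) (reg 18))
    (assign 16 (minus (reg 16) (reg 18)) ⨟ assign 17 (plus (reg 17) (lit 1)))

/-- Writes the thresholds to the array 4. -/
def computeThresholds : RamProgram :=
  store 4 (reg 2) (lit 1) ⨟ assign 15 (reg 2) ⨟
  loop (minus (reg 15) (lit 1))
    (assign 16 (get 4 (reg 15)) ⨟ assign 18 (minus (reg 0) (reg 15)) ⨟ divide ⨟
    store 4 (minus (reg 15) (lit 1)) (plus (plus (get 4 (reg 15)) (reg 17)) (reg 1)) ⨟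
    assign 15 (minus (reg 15) (lit 1)))

/-- The algorithm. -/
def findLoosePath : RamProgram :=
  computeThresholds ⨟ assign 6 (lit 1) ⨟ depthFirstSearch

end RamProgram

namespace Runs

open RamProgram RamExpr

variable {n k r : ℕ} {χ : EdgeColoring n k r} {s : RamState}

/-- Repeated subtraction takes time linear in the dividend, which is affordable because all
thresholds are at most `n`. -/
theorem divide (h : 1 ≤ s.reg 18) :
    Runs χ divide s (20 * s.reg 16 + 20) fun s' => s'.reg 17 = s.reg 16 / s.reg 18 := by
  refine le_time (seq_assign (conseq (loop
    (fun s' => s'.reg 17 * s.reg 18 + s'.reg 16 = s.reg 16) (fun s' => s'.reg 16) 8 ?_ ?_)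
    (T' := 20 * s.reg 16 + 10) ?_ ?_)) ?_
  · simp [eval]
  · rintro s' ha h₁ hb
    have e18 : s'.reg 18 = s.reg 18 := by simpa using ha.reg 18 (by decide)
    simp only [eval, e18] at hb
    refine le_time (seq_assign (assign ?_)) (by simp [cost])
    simp only [eval, e18, RamState.setReg_reg, if_true, Nat.reduceEqDiff, if_false, add_one_mul]
    omega
  · simp [eval, cost]
    omega
  · rintro s' ha ⟨h₁, hb⟩
    have e18 : s'.reg 18 = s.reg 18 := by simpa using ha.reg 18 (by decide)
    simp only [eval, e18] at hb
    rw [← h₁, add_comm, Nat.add_mul_div_right _ _ h, Nat.div_eq_of_lt (by omega), zero_add]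
  · simp [cost]
    omega

theorem computeThresholds (hr : 1 ≤ s.reg 2) (hrk : s.reg 2 < s.reg 0)
    {M : ℕ} (hM : ∀ a, 1 ≤ a → a ≤ s.reg 2 →
      threshold (s.reg 0 - s.reg 2) (s.reg 1) (s.reg 2 - a) ≤ M) :
    Runs χ computeThresholds s (s.reg 2 * (20 * M + 60) + 20) fun s' =>
      ∀ a, 1 ≤ a → a ≤ s.reg 2 →
        s'.arr 4 a = threshold (s.reg 0 - s.reg 2) (s.reg 1) (s.reg 2 - a) := by
  refine le_time (seq_store (seq_assign (conseq (loop
    (fun s' => 1 ≤ s'.reg 15 ∧ s'.reg 15 ≤ s.reg 2 ∧ ∀ a, s'.reg 15 ≤ a → a ≤ s.reg 2 →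
        s'.arr 4 a = threshold (s.reg 0 - s.reg 2) (s.reg 1) (s.reg 2 - a))
    (fun s' => s'.reg 15) (20 * M + 50) ?_ ?_)
    (T' := s.reg 2 * (20 * M + 60) + 10) ?_ ?_))) ?_
  · simp only [eval, RamState.setReg_reg, RamState.setReg_arr, RamState.setArr_arr,
      RamState.setArr_reg, if_true]
    refine ⟨hr, le_rfl, fun a ha ha' => ?_⟩
    obtain rfl : a = s.reg 2 := by omega
    rw [Function.update_self, Nat.sub_self, threshold]
  · rintro s' ha ⟨h₁, h₂, h₃⟩ hb
    have e0 : s'.reg 0 = s.reg 0 := by simpa using ha.reg 0 (by decide)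
    have e1 : s'.reg 1 = s.reg 1 := by simpa using ha.reg 1 (by decide)
    simp only [eval] at hb
    have h₄ := h₃ (s'.reg 15) le_rfl h₂
    have h₅ := hM (s'.reg 15) h₁ h₂
    refine le_time (seq_assign (seq_assign (seq_of (T := 20 * M + 20) (T' := 20)
      (le_time (divide ?_) ?_) fun s₁ ha₁ h₆ => ?_))) (by simp [cost]; omega)
    · simp [eval, e0]
      omega
    · simp [eval, h₄, h₅]
    · have f15 : s₁.reg 15 = s'.reg 15 := by simpa using ha₁.reg 15 (by decide)
      have f1 : s₁.reg 1 = s.reg 1 := by simpa [e1] using ha₁.reg 1 (by decide)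
      have f4 : s₁.arr 4 = s'.arr 4 := by simpa using ha₁.arr 4 (by decide)
      simp only [eval, RamState.setReg_reg, if_true, Nat.reduceEqDiff, if_false, e0, h₄] at h₆
      refine le_time (seq_store (assign ?_)) (by simp [cost])
      simp only [eval, RamState.setReg_reg, RamState.setReg_arr, RamState.setArr_arr,
        RamState.setArr_reg, if_true, f15, f1, f4, h₄, h₆]
      refine ⟨⟨by omega, by omega, fun a ha ha' => ?_⟩, by omega⟩
      rcases eq_or_ne a (s'.reg 15 - 1) with rfl | hne
      · rw [Function.update_self, show s.reg 2 - (s'.reg 15 - 1) = s.reg 2 - s'.reg 15 + 1 by omega,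
          threshold, show s.reg 0 - s.reg 2 + (s.reg 2 - s'.reg 15) = s.reg 0 - s'.reg 15 by omega]
      · rw [Function.update_of_ne hne]
        exact h₃ a (by omega) ha'
  · simp only [eval, cost, RamState.setReg_reg, if_true, RamState.setArr_reg]
    exact add_le_add (Nat.mul_le_mul_left _ (by omega)) (by omega)
  · rintro s' ha ⟨⟨h₁, h₂, h₃⟩, hb⟩
    simp only [eval] at hb
    exact fun a ha ha' => h₃ a (by omega) ha'
  · simp [cost]
    omega

end Runs

/-! ### The total running time -/

theorem mul_choose_le {k : ℕ} (hk : 3 ≤ k) (n : ℕ) :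
    k * (k + 1) * n.choose (k - 1) ≤ 6 * n ^ (k - 1) := by
  -- Equality holds at `k = 3`, which fixes the constant `6`. The factorial is then absorbed by the
  -- binomial coefficient.
  have h₁ : k * (k + 1) ≤ 6 * (k - 1).factorial := by
    induction k, hk using Nat.le_induction with
    | base => decide
    | succ k hk ih =>
      obtain ⟨j, rfl⟩ : ∃ j, k = j + 1 := ⟨k - 1, by omega⟩
      simp only [Nat.add_sub_cancel, Nat.factorial_succ] at ih ⊢
      nlinarith
  calc _ ≤ 6 * (k - 1).factorial * n.choose (k - 1) := Nat.mul_le_mul_right _ h₁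
    _ = 6 * n.descFactorial (k - 1) := by
      rw [Nat.descFactorial_eq_factorial_mul_choose, mul_assoc]
    _ ≤ _ := Nat.mul_le_mul_left _ (Nat.descFactorial_le_pow _ _)

theorem findLoosePath_spec {k ℓ r n : ℕ} (hk : 3 ≤ k) (hℓ : 1 ≤ ℓ) (hr : 1 ≤ r) (hrk : r < k)
    (hn : (k : ℝ) * ((ℓ : ℝ) + 1) * (r : ℝ) *
      (1 + Real.log (1 + ((r : ℝ) - 1) / ((k : ℝ) - (r : ℝ)))) ≤ (n : ℝ)) :
    FindsMonochromaticLoosePath RamProgram.findLoosePath 20000 k ℓ r n := by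
  intro χ
  have hd₀ := thresholds_of_le hℓ hr hrk hn (d := fun a => threshold (k - r) ℓ (r - a))
    fun _ _ _ => rfl
  have hkn : r * 1 + r * (k * 1) ≤ n := by
    have h₁ := hd₀.sum_le
    have h₂ : r * (k * 1) ≤ r * (k * ℓ) := by gcongr
    have h₃ := card_nsmul_le_sum (Ico 1 (r + 1)) (fun a => threshold (k - r) ℓ (r - a)) 1
      fun a ha => by
        rw [mem_Ico] at ha
        exact hd₀.pos ha.1 (by omega)
    rw [Nat.card_Ico, smul_eq_mul, Nat.add_sub_cancel] at h₃
    omega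
  have hM : ∀ a, 1 ≤ a → a ≤ r → threshold (k - r) ℓ (r - a) ≤ n := by
    intro a ha har
    refine le_trans ?_ ((Nat.le_add_right _ _).trans hd₀.sum_le)
    exact single_le_sum (f := fun a => threshold (k - r) ℓ (r - a)) (fun _ _ => Nat.zero_le _)
      (mem_Ico.2 ⟨ha, by omega⟩)
  have main : Runs χ RamProgram.findLoosePath (RamState.init k ℓ r n)
      ((r * (20 * n + 60) + 20) + (2 + ((5 * n + 1) *
        (500 * (k * (k + 1) * n.choose (k - 1)) + 20 * n + 64) + 4))) fun s' =>
      ∃ φ : Fin ((k - 1) * ℓ + 1) ↪ Fin n,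
        (∀ j : Fin ((k - 1) * ℓ + 1), s'.arr 0 (j : ℕ) = (φ j : ℕ)) ∧
          IsMonochromaticCopy (loosePath k ℓ) χ φ := by
    refine Runs.seq_of (Runs.computeThresholds (s := RamState.init k ℓ r n) hr hrk hM)
      fun s₁ ha₁ h₁ => Runs.seq_assign ?_
    have f0 : s₁.arr 0 = fun _ => 0 := ha₁.arr 0 (by decide)
    have f2 : s₁.arr 2 = fun _ => 0 := ha₁.arr 2 (by decide)
    have e0 : s₁.reg 0 = k := ha₁.reg 0 (by decide)
    have e1 : s₁.reg 1 = ℓ := ha₁.reg 1 (by decide)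
    have e2 : s₁.reg 2 = r := ha₁.reg 2 (by decide)
    have e3 : s₁.reg 3 = n := ha₁.reg 3 (by decide)
    have e4 : s₁.reg 4 = 0 := ha₁.reg 4 (by decide)
    have e5 : s₁.reg 5 = 0 := ha₁.reg 5 (by decide)
    have e7 : s₁.reg 7 = 0 := ha₁.reg 7 (by decide)
    have hd := thresholds_of_le hℓ hr hrk hn h₁
    refine (Runs.depthFirstSearch hd (by omega) ?_ ?_ ?_ ?_ ?_ ?_ ?_ ?_).le_time ?_
    all_goals simp only [RamExpr.eval, RamState.setReg_reg, RamState.setReg_arr, if_true,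
      Nat.reduceEqDiff, if_false, e0, e1, e2, e3, e4, e5, e7, f0, f2, OfNat.zero_ne_ofNat,
      OfNat.one_ne_ofNat]
    · exact SearchInv.init hd
    · exact hd.pos le_rfl hr
    · simp
    · refine add_le_add_left (Nat.mul_le_mul_right _ ?_) _
      have h₂ : pathCount (0 * (k - 1)) (fun _ => 0) (fun _ => 0) (r + 1 + 1) = 0 := by
        simp [pathCount]
      have h₃ : classCount n (fun _ => 0) 0 ≤ n := (card_filter_le _ _).trans (by simp)
      rw [searchPotential, h₂]
      split_ifs <;> omega
  obtain ⟨s', t, hex, ht, hφ⟩ := main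
  refine ⟨s', t, hex, ?_, hφ⟩
  have hT : t ≤ 20000 * n ^ k := by
    refine ht.trans ?_
    have h₁ := mul_choose_le hk n
    have hn1 : 1 ≤ n := by nlinarith
    have hrn : r ≤ n := by nlinarith
    have h₂ : n ^ k = n * n ^ (k - 1) := by
      rw [← pow_succ', Nat.sub_add_cancel (by omega)]
    have h₃ : n ≤ n ^ (k - 1) := Nat.le_self_pow (by omega) n
    rw [h₂]
    generalize n ^ (k - 1) = P at *
    generalize k * (k + 1) * n.choose (k - 1) = B at *
    have h₄ : n * n ≤ n * P := Nat.mul_le_mul_left _ h₃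
    have h₅ : r * n ≤ n * n := Nat.mul_le_mul_right _ hrn
    have h₆ : n * B ≤ n * (6 * P) := Nat.mul_le_mul_left _ h₁
    nlinarith
  exact_mod_cast hT

theorem corollary4 :
    ∃ (A : RamProgram) (c : ℝ), 0 < c ∧
      (∀ k ℓ r n : ℕ, 3 ≤ k → 3 ≤ ℓ → 2 ≤ r → r ≤ k - 1 →
        (k : ℝ) * ((ℓ : ℝ) + 1) * (r : ℝ) *
            (1 + Real.log (1 + ((r : ℝ) - 1) / ((k : ℝ) - (r : ℝ)))) ≤ (n : ℝ) →
        FindsMonochromaticLoosePath A c k ℓ r n) ∧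
      (∀ k ℓ r n : ℕ, 3 ≤ k → 3 ≤ ℓ → 2 ≤ r → r ≤ k - 1 →
        (k : ℝ) * ((ℓ : ℝ) + 1) * (r : ℝ) * (1 + Real.log (r : ℝ)) ≤ (n : ℝ) →
        FindsMonochromaticLoosePath A c k ℓ r n) := by
  refine ⟨RamProgram.findLoosePath, 20000, by norm_num, fun k ℓ r n hk hℓ hr hrk hn => ?_,
    fun k ℓ r n hk hℓ hr hrk hn => ?_⟩
  · exact findLoosePath_spec hk (by omega) (by omega) (by omega) hn
  · refine findLoosePath_spec hk (by omega) (by omega) (by omega) (le_trans ?_ hn)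
    have hr' : (2 : ℝ) ≤ r := by exact_mod_cast hr
    have hkr : (1 : ℝ) ≤ (k : ℝ) - r := by
      have : ((r + 1 : ℕ) : ℝ) ≤ k := by exact_mod_cast (show r + 1 ≤ k by omega)
      push_cast at this
      linarith
    -- Since `k - r ≥ 1`, the argument of the logarithm is at most `r`, so the second bound on `n`
    -- implies the first.
    have hdiv : ((r : ℝ) - 1) / ((k : ℝ) - r) ≤ (r : ℝ) - 1 := div_le_self (by linarith) hkr
    have hdiv0 : 0 ≤ ((r : ℝ) - 1) / ((k : ℝ) - r) := div_nonneg (by linarith) (by linarith)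
    have hlog := Real.log_le_log (by linarith)
      (show 1 + ((r : ℝ) - 1) / ((k : ℝ) - r) ≤ r by linarith)
    gcongr
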